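/- Let $l\ge 1$ be an odd integer, $\sigma_l(n)=\sum_{d\mid n}d^l$ and $\varepsilon=(-1)^{(l+1)/2}$. Put $\varphi(s)=\zeta(s)\zeta(s-l)$ and $\psi(s)=\varepsilon\,\zeta(s)\zeta(s-l)$; for $\Re s>l+1$ these are the Dirichlet series $\sum_{n\ge1} f(n)n^{-s}$ and $\sum_{n\ge1} g(n)n^{-s}$ with $f=\sigma_l$ and $g=\varepsilon\sigma_l$. For $a\in\mathbb C$ let $$f_a(n)=\sum_{d\mid n}d^a\,\sigma_l(d)\,\sigma_l(n/d).$$ Let $k>l+1$ be an integer and let $\gamma$ be a real number with $\gamma>l+1$ and $2\gamma-(l+1)<k$. For $z>0$ put $$G^{1,1}_{3,1}\left({}^{1,\,b,\,c}_{d}\,\middle|\,z\right)=\frac1{2\pi i}\int_{\gamma-i\infty}^{\gamma+i\infty}\frac{\Gamma(d-s)\,\Gamma(s)}{\Gamma(b-s)\,\Gamma(c-s)}\,z^s\,ds,$$ and for $u,v\in\mathbb C$, $x>0$ put $$G_{\sigma_l,k}(u,v,x)=(2\pi)^{l+1}\sum_{n=1}^\infty f_{l+1-u-v}(n)\,x^{l+1-u+k}\,G^{1,1}_{3,1}\left({}^{1,\;l+1-u+k+1,\;l+1}_{l+1-u}\,\middle|\,\frac1{4\pi^2nx}\right).$$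 Let $u,v\in\mathbb C\setminus\{1,l+1\}$ satisfy $\Re u+\Re v>2l+2$ and $\Re u,\Re v>l+1-\gamma$ (the last condition holds in particular whenever $\Re u,\Re v>l+1$), and suppose that none of the points $l+1-u+j$, $l+1-v+j$ $(0\le j\le k)$ lies on the line $\Re s=\gamma$. Then for every $x>0$ the integrals and the series defining $G_{\sigma_l,k}(u,v,x)$ and $G_{\sigma_l,k}(v,u,x)$ converge absolutely. As functions of $x$, both are $k-1$ times continuously differentiable near $x=1$, and their $(k-1)$-st derivatives have a left and a right derivative at $x=1$. Writing $\left.\frac{d^{(k)}}{dx}\right|_{x=1}$ for the arithmetic mean of these two one-sided $k$-th derivatives, we have \begin{align*} \varphi(u)\psi(v)={}&-\varepsilon\,\frac{\zeta(1-l)}{1-v}\,\varphi(u+v-1)-\varepsilon\,\frac{\zeta(1+l)}{l+1-v}\,\varphi(u+v-l-1)\\ &-\frac{\zeta(1-l)}{1-u}\,\psi(u+v-1)-\frac{\zeta(1+l)}{l+1-u}\,\psi(u+v-l-1)\\ &-\left.\frac{d^{(k)}}{dx}\right|_{x=1}G_{\sigma_l,k}(u,v,x)-\left.\frac{d^{(k)}}{dx}\right|_{x=1}G_{\sigma_l,k}(v,u,x).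 \end{align*} -/

import Mathlib

noncomputable section

/-- `φ(s) = ζ(s) ζ(s - l)`, the Dirichlet series of `f = σ_l`, continued to the plane. -/
def divisorPhi (l : ℕ) (s : ℂ) : ℂ := riemannZeta s * riemannZeta (s - l)

/-- `ψ(s) = (-1)^((l+1)/2) ζ(s) ζ(s - l)`, the Dirichlet series of `g = (-1)^((l+1)/2) σ_l`
(used for odd `l`, where `(l + 1) / 2` is an exact division). -/
def divisorPsi (l : ℕ) (s : ℂ) : ℂ := (-1 : ℂ) ^ ((l + 1) / 2) * divisorPhi l s

/-- The integrand `Γ(d - s) Γ(s) / (Γ(b - s) Γ(c - s)) * z ^ s` of the Meijer function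
`G^{1,1}_{3,1}(1, b, c; d | z)`. -/
def meijerIntegrand (b c d z s : ℂ) : ℂ :=
  Complex.Gamma (d - s) * Complex.Gamma s / (Complex.Gamma (b - s) * Complex.Gamma (c - s)) * z ^ s

/-- `G^{1,1}_{3,1}(1, b, c; d | z) = (2πi)⁻¹ ∫_L Γ(d - s) Γ(s) / (Γ(b - s) Γ(c - s)) z ^ s ds`,
the path `L` being the vertical line `Re s = γ`, run upwards. -/
def meijerG (γ : ℝ) (b c d z : ℂ) : ℂ :=
  1 / (2 * Real.pi * Complex.I) *
    ∫ t : ℝ, meijerIntegrand b c d z (γ + t * Complex.I) * Complex.I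

/-- `f_a(n) = ∑_{d ∣ n} d ^ a σ_l(d) σ_l(n / d)`; in particular `f_a(0) = 0` (an empty sum). -/
def divisorConv (l : ℕ) (a : ℂ) (n : ℕ) : ℂ :=
  ∑ d ∈ n.divisors,
    (d : ℂ) ^ a * (ArithmeticFunction.sigma l d : ℂ) * (ArithmeticFunction.sigma l (n / d) : ℂ)

/-- The `n`-th term of the series in `divisorG`. It vanishes for `n = 0`. -/
def divisorGTerm (l k : ℕ) (γ : ℝ) (u v : ℂ) (x : ℝ) (n : ℕ) : ℂ :=
  divisorConv l (l + 1 - u - v) n * (x : ℂ) ^ (l + 1 - u + k : ℂ) *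
    meijerG γ (l + 1 - u + k + 1) (l + 1) (l + 1 - u) (1 / (4 * Real.pi ^ 2 * n * x))

/-- `G_{σ_l,k}(u, v, x) = (2π)^(l+1) ∑_{n ≥ 1} f_{l+1-u-v}(n) x^(l+1-u+k)
G^{1,1}_{3,1}(1, l+1-u+k+1, l+1; l+1-u | 1/(4π²nx))`. The factor `1/(2πi)` is in `meijerG`. -/
def divisorG (l k : ℕ) (γ : ℝ) (u v : ℂ) (x : ℝ) : ℂ :=
  (2 * Real.pi : ℂ) ^ (l + 1) * ∑' n : ℕ, divisorGTerm l k γ u v x n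

/-- For every `x > 0` the integrals and the series in `divisorG l k γ u v x` converge absolutely. -/
def DivisorGConverges (l k : ℕ) (γ : ℝ) (u v : ℂ) : Prop :=
  ∀ x : ℝ, 0 < x →
    (∀ n : ℕ, 0 < n → MeasureTheory.Integrable fun t : ℝ =>
      meijerIntegrand (l + 1 - u + k + 1) (l + 1) (l + 1 - u) (1 / (4 * Real.pi ^ 2 * n * x))
        (γ + t * Complex.I)) ∧
    Summable (divisorGTerm l k γ u v x)

/-- For `k ≥ 1`: `F` is `k - 1` times continuously differentiable near `x₀`, its `(k-1)`-st
derivative has a left and a right derivative at `x₀`, and `D` is their mean.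
If `F` is `k` times differentiable at `x₀`, then `D` is the ordinary `k`-th derivative. -/
def HasMeanIteratedDerivAt (k : ℕ) (F : ℝ → ℂ) (D : ℂ) (x₀ : ℝ) : Prop :=
  ContDiffAt ℝ (k - 1 : ℕ) F x₀ ∧
  ∃ D₁ D₂ : ℂ,
    HasDerivWithinAt (iteratedDeriv (k - 1) F) D₁ (Set.Iic x₀) x₀ ∧
    HasDerivWithinAt (iteratedDeriv (k - 1) F) D₂ (Set.Ici x₀) x₀ ∧
    D = (D₁ + D₂) / 2

end

open Complex Set Filter Topology Asymptotics MeasureTheory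
open scoped Real

/-! Put F(w) = φ(u + w) φ(v - w) and ε = (-1)^((l+1)/2). After the substitution s = l + 1 - u - w in
the Meijer integrals, the sum over n produces the Dirichlet series φ(v - w) φ(l + 1 - u - w), and
the functional equation absorbs the Gamma quotient together with φ(l + 1 - u - w) into φ(u + w). So
G(u, v, x) is ε/(2π) times the Riesz mean ∫ F(w) x^(w+k) / (w(w+1)⋯(w+k)) dy over w = c₁ + iy with
c₁ = l + 1 - Re u - γ (`divisorG_eq_rieszIntegral`).

Since Re u + Re v > 2l + 2, there is a line Re w = c on which both factors of F are absolutely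
convergent Dirichlet series. By convexity φ grows at most like |Im|^k in the strip between the
lines; this uses 2γ - (l + 1) ≤ k. Hence moving the line costs only a contour integral over a
bounded rectangle (`rieszIntegral_sub_rieszIntegral`). The k-th derivative of that integral at x = 1
is the contour integral of F(w)/w, that is, the residues at 1 - u and l + 1 - u, and also φ(u)φ(v)
from w = 0 when c > 0 (`rectIntegral_divisorPair_div`).

On Re w = c, k - 1 differentiations leave the Riesz mean of order 1. Expanding F and using Perron's
formula turns it into a series of ramps max(x - m/n, 0), which has one-sided derivatives D₁, D₂ at 1
(`exists_hasDerivWithinAt_rieszIntegral_one`). The terms m = n have their kink exactly at 1.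

G(v, u, x) is treated on the line Re w = -c. The reflection w ↦ -w turns the pair D₁, D₂ into -D₂,
-D₁ (`hasDerivWithinAt_rieszIntegral_neg`), so in the sum of the two means these unknown derivatives
cancel and need not be computed. As c > 0 > -c, the product φ(u)φ(v) is picked up exactly once, and
the remaining residues are the four explicit terms. -/

/-! ### Convexity in vertical strips -/

/-- Replacing the weight (1 + |t|)^ρ by (1 + |T|)^ρ costs at most exp(|ρ| |t - T|), which a Gaussian
in t - T absorbs. -/
theorem abs_log_one_add_abs_sub_le (t T : ℝ) :
    |Real.log (1 + |t|) - Real.log (1 + |T|)| ≤ |t - T| := by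
  have key : ∀ x y : ℝ, Real.log (1 + |x|) - Real.log (1 + |y|) ≤ |x - y| := by
    intro x y
    have hx : 0 < 1 + |x| := by positivity
    have hy : 0 < 1 + |y| := by positivity
    rw [← Real.log_div hx.ne' hy.ne']
    have h1 := Real.log_le_sub_one_of_pos (div_pos hx hy)
    have h2 : (1 + |x|) / (1 + |y|) - 1 ≤ |x - y| := by
      rw [div_sub_one hy.ne', div_le_iff₀ hy]
      have h3 := abs_sub_abs_le_abs_sub x y
      nlinarith [abs_nonneg (x - y), abs_nonneg y]
    linarith
  refine abs_le.2 ⟨?_, key t T⟩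
  have := key T t
  rw [abs_sub_comm] at this
  linarith

/-- A convexity bound: growth exponents interpolate linearly in vertical strips. -/
theorem exists_norm_le_rpow_of_verticalStrip {F : ℂ → ℂ} {a b α β A B C : ℝ} (hab : a < b)
    (hF : DiffContOnCl ℂ F (re ⁻¹' Ioo a b))
    (hgrow : ∀ s : ℂ, a ≤ s.re → s.re ≤ b → ‖F s‖ ≤ B * Real.exp (A * |s.im|))
    (ha : ∀ s : ℂ, s.re = a → ‖F s‖ ≤ C * (1 + |s.im|) ^ α)
    (hb : ∀ s : ℂ, s.re = b → ‖F s‖ ≤ C * (1 + |s.im|) ^ β) :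
    ∃ C', ∀ s : ℂ, a ≤ s.re → s.re ≤ b →
      ‖F s‖ ≤ C' * (1 + |s.im|) ^ (α + (β - α) * ((s.re - a) / (b - a))) := by
  have hba : 0 < b - a := sub_pos.2 hab
  have hC : 0 ≤ C := by
    have := (norm_nonneg _).trans (ha a (by simp))
    simpa using this
  set D := C * Real.exp (α ^ 2 + β ^ 2 + a ^ 2 + b ^ 2) with hD
  refine ⟨D, fun s₀ h₁ h₂ => ?_⟩
  set T := s₀.im
  set L := Real.log (1 + |T|)
  have hT : 0 < 1 + |T| := by positivity
  have hL : 0 ≤ L := Real.log_nonneg (by linarith [abs_nonneg T])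
  set e : ℝ → ℝ := fun σ => α + (β - α) * ((σ - a) / (b - a)) with he
  -- The height T of the target point is frozen, so division by (1 + |T|)^e(s) is multiplication by
  -- an entire function. The square gives Gaussian decay away from height T, which makes the edge
  -- bounds independent of T. At the target point the square is real and nonnegative, so nothing is
  -- lost there.
  set m : ℂ → ℂ := fun s => (s - T * I) ^ 2 - L * (α + (β - α) * ((s - a) / (b - a))) with hm
  have hmre : ∀ s : ℂ, (m s).re = s.re ^ 2 - (s.im - T) ^ 2 - L * e s.re := by
    intro s
    have : (L * (α + (β - α) * ((s - a) / (b - a))) : ℂ).re = L * e s.re := by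
      rw [← ofReal_sub, ← ofReal_sub, re_ofReal_mul, add_re, re_ofReal_mul, div_ofReal_re, sub_re]
      simp [he]
    rw [hm]
    simp only [sub_re, this]
    simp [pow_two]
  have hgn : ∀ s : ℂ, ‖F s * cexp (m s)‖ =
      ‖F s‖ * Real.exp (s.re ^ 2 - (s.im - T) ^ 2 - L * e s.re) := by
    intro s
    rw [norm_mul, Complex.norm_exp, hmre]
  have hedge : ∀ (s : ℂ) (ρ : ℝ), ‖F s‖ ≤ C * (1 + |s.im|) ^ ρ → e s.re = ρ →
      ‖F s * cexp (m s)‖ ≤ C * Real.exp (ρ ^ 2 + s.re ^ 2) := by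
    intro s ρ h hρ
    rw [hgn, hρ]
    have hpos : 0 < 1 + |s.im| := by positivity
    calc ‖F s‖ * Real.exp (s.re ^ 2 - (s.im - T) ^ 2 - L * ρ)
        ≤ (C * (1 + |s.im|) ^ ρ) * Real.exp (s.re ^ 2 - (s.im - T) ^ 2 - L * ρ) := by gcongr
      _ = C * Real.exp (ρ * (Real.log (1 + |s.im|) - L) + s.re ^ 2 - (s.im - T) ^ 2) := by
          rw [Real.rpow_def_of_pos hpos, mul_assoc, ← Real.exp_add]; ring_nf
      _ ≤ C * Real.exp (ρ ^ 2 + s.re ^ 2) := by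
          gcongr
          have h1 : ρ * (Real.log (1 + |s.im|) - L) ≤ |ρ| * |s.im - T| :=
            (le_abs_self _).trans (by
              rw [abs_mul]
              exact mul_le_mul_of_nonneg_left (abs_log_one_add_abs_sub_le _ _) (abs_nonneg _))
          nlinarith [sq_nonneg (|ρ| - |s.im - T|), sq_abs ρ, sq_abs (s.im - T)]
  have hfin := PhragmenLindelof.vertical_strip (f := fun s => F s * cexp (m s)) (C := D)
    (a := a) (b := b) (z := s₀) ?_ ?_ ?_ ?_ h₁ h₂
  · rw [hgn, sub_self] at hfin
    have h3 : Real.rpow (1 + |T|) (e s₀.re) = Real.exp (L * e s₀.re) :=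
      Real.rpow_def_of_pos hT _
    change _ ≤ D * Real.rpow (1 + |T|) (e s₀.re)
    rw [h3]
    calc ‖F s₀‖ = ‖F s₀‖ * Real.exp (0 - L * e s₀.re) * Real.exp (L * e s₀.re) := by
          rw [mul_assoc, ← Real.exp_add]; simp
      _ ≤ ‖F s₀‖ * Real.exp (s₀.re ^ 2 - 0 ^ 2 - L * e s₀.re) * Real.exp (L * e s₀.re) := by
          gcongr; nlinarith [sq_nonneg s₀.re]
      _ ≤ D * Real.exp (L * e s₀.re) := by gcongr
  · refine hF.smul (Differentiable.diffContOnCl ?_)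
    fun_prop
  -- Phragmén–Lindelöf allows growth exp(B exp(r|Im s|)) for any r < π/(b - a); r = 1/(b - a) is
  -- ample for a simple exponential.
  · refine ⟨1 / (b - a), by gcongr; linarith [Real.pi_gt_three], |A| * (b - a), ?_⟩
    have hB : 0 ≤ B := by
      have := (norm_nonneg _).trans (hgrow a (by simp) (by simpa using hab.le))
      simpa using this
    refine IsBigO.of_bound (B * Real.exp (a ^ 2 + b ^ 2 + L * (|α| + |β - α|))) ?_
    refine Filter.mem_inf_of_right ?_
    rintro s ⟨hs1, hs2⟩
    simp only [Set.mem_ofPred_eq]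
    rw [hgn, Real.norm_of_nonneg (Real.exp_pos _).le]
    have hx : (s.re - a) / (b - a) ∈ Icc (0 : ℝ) 1 :=
      ⟨div_nonneg (by linarith) hba.le, (div_le_one hba).2 (by linarith)⟩
    have he' : |e s.re| ≤ |α| + |β - α| := by
      refine (abs_add_le _ _).trans ?_
      rw [abs_mul, abs_of_nonneg hx.1]
      gcongr
      exact mul_le_of_le_one_right (abs_nonneg _) hx.2
    have hLe : -(L * e s.re) ≤ L * (|α| + |β - α|) := by
      have := neg_le_of_abs_le he'
      nlinarith
    have hsq : s.re ^ 2 ≤ a ^ 2 + b ^ 2 := by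
      rcases le_total 0 s.re with h | h
      · nlinarith [sq_nonneg a]
      · nlinarith [sq_nonneg b]
    have hA : A * |s.im| ≤ |A| * (b - a) * Real.exp (1 / (b - a) * |s.im|) := by
      have h4 : 1 / (b - a) * |s.im| ≤ Real.exp (1 / (b - a) * |s.im|) := by
        linarith [Real.add_one_le_exp (1 / (b - a) * |s.im|)]
      calc A * |s.im| ≤ |A| * |s.im| := by gcongr; exact le_abs_self A
        _ = |A| * (b - a) * (1 / (b - a) * |s.im|) := by field_simp
        _ ≤ _ := by gcongr
    calc ‖F s‖ * Real.exp (s.re ^ 2 - (s.im - T) ^ 2 - L * e s.re)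
        ≤ (B * Real.exp (A * |s.im|)) * Real.exp (a ^ 2 + b ^ 2 + L * (|α| + |β - α|)) := by
          gcongr
          · exact hgrow s hs1.le hs2.le
          · nlinarith [sq_nonneg (s.im - T)]
      _ = B * Real.exp (a ^ 2 + b ^ 2 + L * (|α| + |β - α|)) * Real.exp (A * |s.im|) := by ring
      _ ≤ _ := by gcongr
  · intro s hs
    refine (hedge s α (ha s hs) (by simp [he, hs])).trans ?_
    rw [hD, hs]
    refine mul_le_mul_of_nonneg_left (Real.exp_le_exp.2 ?_) hC
    nlinarith [sq_nonneg β, sq_nonneg b]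
  · intro s hs
    refine (hedge s β (hb s hs) (by simp [he, hs, div_self hba.ne'])).trans ?_
    rw [hD, hs]
    refine mul_le_mul_of_nonneg_left (Real.exp_le_exp.2 ?_) hC
    nlinarith [sq_nonneg α, sq_nonneg a]

/-! ### Growth of Γ, 1/Γ and ζ -/

/-- `Γ` is bounded in vertical strips to the right of the imaginary axis. -/
theorem Complex.norm_Gamma_le_Gamma_re {s : ℂ} (hs : 0 < s.re) : ‖Gamma s‖ ≤ Real.Gamma s.re := by
  rw [Gamma_eq_integral hs, GammaIntegral, Real.Gamma_eq_integral hs]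
  refine (norm_integral_le_integral_norm _).trans (le_of_eq ?_)
  refine setIntegral_congr_fun measurableSet_Ioi fun x (hx : 0 < x) => ?_
  simp only [norm_mul, norm_real, Real.norm_of_nonneg (Real.exp_pos _).le]
  rw [norm_cpow_eq_rpow_re_of_pos hx]
  simp

theorem Complex.norm_sin_le_exp (s : ℂ) : ‖sin s‖ ≤ Real.exp |s.im| := by
  rw [Complex.sin, norm_div, norm_mul, norm_I, mul_one, norm_ofNat]
  have h1 : ‖cexp (-s * I)‖ ≤ Real.exp |s.im| := by
    rw [Complex.norm_exp]; gcongr; simp [le_abs_self]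
  have h2 : ‖cexp (s * I)‖ ≤ Real.exp |s.im| := by
    rw [Complex.norm_exp]; gcongr; simp [neg_le_abs]
  linarith [norm_sub_le (cexp (-s * I)) (cexp (s * I))]

/-- `1/Γ` grows at most exponentially in vertical strips. -/
theorem Complex.exists_norm_inv_Gamma_le (a b : ℝ) :
    ∃ C, ∀ s : ℂ, a ≤ s.re → s.re ≤ b → ‖(Gamma s)⁻¹‖ ≤ C * Real.exp (π * |s.im|) := by
  -- The left end must stay arbitrary, since the induction step applies the bound to s - 1. The base
  -- case Re s ≤ 1/2 is the reflection formula. The step uses Γ(s) = (s - 1)Γ(s - 1) for |Im s| > 1,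
  -- where |s - 1| ≥ 1, and compactness for |Im s| ≤ 1.
  have key : ∀ (n : ℕ) (a : ℝ), ∃ C, ∀ s : ℂ, a ≤ s.re → s.re ≤ 1 / 2 + n →
      ‖(Gamma s)⁻¹‖ ≤ C * Real.exp (π * |s.im|) := by
    intro n
    induction n with
    | zero =>
      intro a
      have hcont : ContinuousOn Real.Gamma (Icc (1 / 2) (1 - a)) := fun x hx =>
        (Real.differentiableAt_Gamma fun m => by
          have := hx.1
          have hm : (0 : ℝ) ≤ m := m.cast_nonneg
          intro h
          linarith).continuousAt.continuousWithinAt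
      obtain ⟨M, hM⟩ := isCompact_Icc.exists_bound_of_continuousOn hcont
      refine ⟨M / π, fun s h1 h2 => ?_⟩
      have hrefl := Gamma_mul_Gamma_one_sub s
      have h3 : (1 - s).re ∈ Icc (1 / 2) (1 - a) := by
        simp only [sub_re, one_re, mem_Icc]
        constructor <;> [skip; linarith]
        simp at h2
        linarith
      have h4 : ‖Gamma (1 - s)‖ ≤ M :=
        (norm_Gamma_le_Gamma_re (by linarith [h3.1])).trans ((le_abs_self _).trans (hM _ h3))
      have h5 : ‖sin (π * s)‖ ≤ Real.exp (π * |s.im|) := by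
        refine (norm_sin_le_exp _).trans (le_of_eq ?_)
        simp [abs_mul, abs_of_pos Real.pi_pos]
      have hM0 : 0 ≤ M := (norm_nonneg _).trans h4
      by_cases hG : Gamma s = 0
      · simp only [hG, inv_zero, norm_zero]; positivity
      by_cases hsin : sin (π * s) = 0
      · have h6 : Gamma (1 - s) = 0 := by
          rw [hsin, div_zero] at hrefl
          exact (mul_eq_zero.1 hrefl).resolve_left hG
        exact absurd h6 (Gamma_ne_zero_of_re_pos (by linarith [h3.1]))
      have h7 : (Gamma s)⁻¹ = Gamma (1 - s) * sin (π * s) / π := by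
        have hpi : (π : ℂ) ≠ 0 := ofReal_ne_zero.2 Real.pi_ne_zero
        rw [eq_div_iff hsin] at hrefl
        rw [inv_eq_iff_eq_inv, inv_div, eq_div_iff (by
          intro h0; rw [mul_assoc] at hrefl; rw [h0, mul_zero] at hrefl; exact hpi hrefl.symm)]
        linear_combination hrefl
      rw [h7, norm_div, norm_mul, norm_real, Real.norm_of_nonneg Real.pi_pos.le, div_mul_eq_mul_div]
      gcongr
    | succ n ih =>
      intro a
      obtain ⟨C, hC⟩ := ih (a - 1)
      have hcpt : IsCompact (Icc a (1 / 2 + (n + 1 : ℕ)) ×ℂ Icc (-1) 1) :=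
        isCompact_Icc.reProdIm isCompact_Icc
      obtain ⟨M, hM⟩ := hcpt.exists_bound_of_continuousOn
        differentiable_one_div_Gamma.continuous.continuousOn
      refine ⟨max C (max M 0), fun s h1 h2 => ?_⟩
      by_cases him : |s.im| ≤ 1
      · calc ‖(Gamma s)⁻¹‖ ≤ M := hM s ⟨⟨h1, h2⟩, abs_le.1 him⟩
          _ ≤ max C (max M 0) := (le_max_left _ _).trans (le_max_right _ _)
          _ ≤ max C (max M 0) * Real.exp (π * |s.im|) :=
            le_mul_of_one_le_right ((le_max_right _ _).trans (le_max_right _ _))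
              (Real.one_le_exp (by positivity))
      push Not at him
      by_cases hs : s.re ≤ 1 / 2 + n
      · refine (hC s (by linarith) hs).trans ?_
        gcongr
        exact le_max_left _ _
      · have h3 := hC (s - 1) (by simpa using h1) (by
          push_cast at h2; simp only [sub_re, one_re]; linarith)
        have hne : s - 1 ≠ 0 := by
          intro h0
          have := congrArg Complex.im h0
          simp at this
          rw [this] at him; simp at him; linarith
        have h4 : Gamma s = (s - 1) * Gamma (s - 1) := by
          rw [← Gamma_add_one _ hne]; ring_nf
        have h5 : 1 ≤ ‖s - 1‖ := him.le.trans (by simpa using abs_im_le_norm (s - 1))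
        rw [h4, mul_inv, norm_mul, norm_inv]
        calc ‖s - 1‖⁻¹ * ‖(Gamma (s - 1))⁻¹‖ ≤ 1 * ‖(Gamma (s - 1))⁻¹‖ := by
              gcongr; exact inv_le_one_of_one_le₀ h5
          _ ≤ C * Real.exp (π * |s.im|) := by simpa using h3
          _ ≤ _ := by gcongr; exact le_max_left _ _
  obtain ⟨n, hn⟩ := exists_nat_ge b
  obtain ⟨C, hC⟩ := key n a
  exact ⟨C, fun s h1 h2 => hC s h1 (by linarith)⟩

/-- On the strip |t^(s-1)| ≤ t^(a-1) + t^(b-1), whichever side of 1 contains t. -/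
theorem exists_norm_mellin_le {f : ℝ → ℂ} {a b : ℝ} (ha : MellinConvergent f a)
    (hb : MellinConvergent f b) :
    ∃ C, ∀ s : ℂ, a ≤ s.re → s.re ≤ b → ‖mellin f s‖ ≤ C := by
  refine ⟨∫ t in Ioi (0 : ℝ), (‖(t : ℂ) ^ ((a : ℂ) - 1) • f t‖ + ‖(t : ℂ) ^ ((b : ℂ) - 1) • f t‖),
    fun s h1 h2 => ?_⟩
  refine norm_integral_le_of_norm_le (Integrable.add ha.norm hb.norm) ?_
  refine (ae_restrict_mem measurableSet_Ioi).mono fun t (ht : 0 < t) => ?_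
  simp only [norm_smul, norm_cpow_eq_rpow_re_of_pos ht, sub_re, ofReal_re, one_re, ← add_mul]
  gcongr
  rcases le_total 1 t with h | h
  · have := Real.rpow_le_rpow_of_exponent_le h (sub_le_sub_right h2 1)
    have := Real.rpow_nonneg ht.le (a - 1)
    linarith
  · have := Real.rpow_le_rpow_of_exponent_ge ht h (sub_le_sub_right h1 1)
    have := Real.rpow_nonneg ht.le (b - 1)
    linarith

/-- This function is half the Mellin transform, at s/2, of a modified theta kernel whose Mellin
integral converges for every s. -/
theorem exists_norm_completedRiemannZeta₀_le (a b : ℝ) :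
    ∃ C, ∀ s : ℂ, a ≤ s.re → s.re ≤ b → ‖completedRiemannZeta₀ s‖ ≤ C := by
  set P := HurwitzZeta.hurwitzEvenFEPair 0
  have hM := (P.isStrongFEPair_toStrongFEPair).hasMellin
  obtain ⟨C, hC⟩ := exists_norm_mellin_le (f := P.f_modif) (a := a / 2) (b := b / 2)
    (hM _).1 (hM _).1
  refine ⟨C / 2, fun s h1 h2 => ?_⟩
  have h3 : completedRiemannZeta₀ s = mellin P.f_modif (s / 2) / 2 := rfl
  have h4 : (s / 2).re = s.re / 2 := by simp
  rw [h3, norm_div, norm_ofNat]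
  gcongr
  exact hC _ (by rw [h4]; linarith) (by rw [h4]; linarith)

/-- The entire function `(s - 1) ζ(s)`. -/
noncomputable def zetaEntire (s : ℂ) : ℂ :=
  ((s - 1) * s * completedRiemannZeta₀ s + 1) * ((π : ℂ) ^ (s / 2) / 2) * (Gamma (s / 2 + 1))⁻¹

theorem zetaEntire_eq {s : ℂ} (hs : s ≠ 1) : zetaEntire s = (s - 1) * riemannZeta s := by
  have h1 : (1 - s : ℂ) ≠ 0 := sub_ne_zero.2 hs.symm
  have hpi : (π : ℂ) ≠ 0 := ofReal_ne_zero.2 Real.pi_ne_zero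
  rw [riemannZeta_eq_mul_completedRiemannZeta₀, zetaEntire, neg_div, cpow_neg]
  have h2 : s * completedRiemannZeta₀ s - 1 - s / (1 - s) =
      -((s - 1) * s * completedRiemannZeta₀ s + 1) / (1 - s) := by
    field_simp; ring
  rw [h2]
  have h3 : (π : ℂ) ^ (s / 2) ≠ 0 := by simp [cpow_eq_zero_iff, hpi]
  by_cases hG : Gamma (s / 2 + 1) = 0
  · simp [hG]
  · field_simp
    ring

theorem zetaEntire_one : zetaEntire 1 = 1 := by
  have h : Gamma (1 / 2 + 1 : ℂ) = (π : ℂ) ^ (1 / 2 : ℂ) / 2 := by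
    rw [Gamma_add_one _ (by norm_num), Gamma_one_half_eq]; ring
  have h3 : (π : ℂ) ^ (1 / 2 : ℂ) ≠ 0 := by
    simp [cpow_eq_zero_iff, Real.pi_ne_zero]
  rw [zetaEntire, h]
  field_simp
  ring

theorem differentiable_zetaEntire : Differentiable ℂ zetaEntire := by
  have hpi : (π : ℂ) ≠ 0 := ofReal_ne_zero.2 Real.pi_ne_zero
  have h1 : Differentiable ℂ fun s : ℂ => (Gamma (s / 2 + 1))⁻¹ :=
    differentiable_one_div_Gamma.comp (by fun_prop : Differentiable ℂ fun s : ℂ => s / 2 + 1)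
  have h2 : Differentiable ℂ fun s : ℂ => (π : ℂ) ^ (s / 2) := fun s =>
    (differentiableAt_id.div_const 2).const_cpow (Or.inl hpi)
  have h3 := differentiable_completedZeta₀
  unfold zetaEntire
  fun_prop

/-- A crude bound, serving only as the a priori growth hypothesis of the convexity theorem. -/
theorem exists_norm_zetaEntire_le (a b : ℝ) :
    ∃ B A, ∀ s : ℂ, a ≤ s.re → s.re ≤ b → ‖zetaEntire s‖ ≤ B * Real.exp (A * |s.im|) := by
  obtain ⟨C₁, h₁⟩ := exists_norm_completedRiemannZeta₀_le a b
  obtain ⟨C₂, h₂⟩ := exists_norm_inv_Gamma_le (a / 2 + 1) (b / 2 + 1)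
  set K := 1 + |a| + |b| with hK
  refine ⟨((K + 1) * K * |C₁| + 1) * π ^ (b / 2) * |C₂|, 2 + π, fun s h1 h2 => ?_⟩
  have hG := h₂ (s / 2 + 1) (by simp; linarith) (by simp; linarith)
  have hs : ‖s‖ ≤ K * Real.exp |s.im| := by
    have h3 : |s.re| ≤ |a| + |b| := by
      rw [abs_le]; constructor
      · linarith [neg_abs_le a, abs_nonneg b]
      · linarith [le_abs_self b, abs_nonneg a]
    have h4 := norm_le_abs_re_add_abs_im s
    have h5 := Real.add_one_le_exp |s.im|
    have h6 : 1 ≤ Real.exp |s.im| := Real.one_le_exp (abs_nonneg _)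
    nlinarith [abs_nonneg a, abs_nonneg b]
  have he : 1 ≤ Real.exp |s.im| := Real.one_le_exp (abs_nonneg _)
  have hs1 : ‖s - 1‖ ≤ (K + 1) * Real.exp |s.im| := by
    have := norm_sub_le s 1
    rw [norm_one] at this
    linarith
  have hL : ‖completedRiemannZeta₀ s‖ ≤ |C₁| := (h₁ s h1 h2).trans (le_abs_self _)
  have hK0 : 0 ≤ K := by positivity
  have hpi : ‖(π : ℂ) ^ (s / 2) / 2‖ ≤ π ^ (b / 2) := by
    rw [norm_div, norm_cpow_eq_rpow_re_of_pos Real.pi_pos, norm_ofNat]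
    have h3 : (s / 2).re = s.re / 2 := by simp
    rw [h3]
    have h4 : π ^ (s.re / 2) ≤ π ^ (b / 2) :=
      Real.rpow_le_rpow_of_exponent_le (by linarith [Real.pi_gt_three]) (by linarith)
    have h5 := Real.rpow_nonneg Real.pi_pos.le (s.re / 2)
    linarith
  have hG' : ‖(Gamma (s / 2 + 1))⁻¹‖ ≤ |C₂| * Real.exp (π * |s.im|) := by
    refine hG.trans ?_
    have h3 : (s / 2 + 1).im = s.im / 2 := by simp
    rw [h3, abs_div, abs_two]
    have := abs_nonneg s.im
    gcongr
    · exact le_abs_self _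
    · linarith
  have hmain : ‖(s - 1) * s * completedRiemannZeta₀ s + 1‖ ≤
      ((K + 1) * K * |C₁| + 1) * Real.exp (2 * |s.im|) := by
    calc ‖(s - 1) * s * completedRiemannZeta₀ s + 1‖
        ≤ ‖s - 1‖ * ‖s‖ * ‖completedRiemannZeta₀ s‖ + 1 := by
          refine (norm_add_le _ _).trans ?_
          simp
      _ ≤ ((K + 1) * Real.exp |s.im|) * (K * Real.exp |s.im|) * |C₁| +
            Real.exp (2 * |s.im|) := by
          gcongr
          exact Real.one_le_exp (by positivity)
      _ = _ := by rw [two_mul, Real.exp_add]; ring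
  rw [zetaEntire, norm_mul, norm_mul]
  calc _ ≤ (((K + 1) * K * |C₁| + 1) * Real.exp (2 * |s.im|)) * π ^ (b / 2) *
        (|C₂| * Real.exp (π * |s.im|)) := by gcongr
    _ = _ := by rw [add_mul 2 π, Real.exp_add]; ring

theorem norm_sub_le_mul_one_add_abs_im (s : ℂ) {K : ℝ} (h : |s.re| ≤ K) (c : ℂ) :
    ‖s - c‖ ≤ (K + ‖c‖ + 1) * (1 + |s.im|) := by
  have h1 := norm_sub_le s c
  have h2 := norm_le_abs_re_add_abs_im s
  have h3 := abs_nonneg s.im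
  have h4 := (abs_nonneg _).trans h
  nlinarith [norm_nonneg c, mul_nonneg h4 h3, mul_nonneg (norm_nonneg c) h3]

theorem closure_verticalStrip_subset {a b : ℝ} : closure (re ⁻¹' Ioo a b) ⊆ re ⁻¹' Icc a b :=
  closure_minimal (preimage_mono Ioo_subset_Icc_self) (isClosed_Icc.preimage continuous_re)

/-! ### Functional equation and polynomial growth of φ -/

/-- Growth of the Gamma quotient `Γ(s) / Γ(l + 1 - s)` on vertical lines. -/
theorem exists_norm_Gamma_div_Gamma_le (l : ℕ) {γ : ℝ} (hγ : ((l : ℝ) + 1) / 2 ≤ γ) :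
    ∃ C, ∀ s : ℂ, s.re = γ →
      ‖Gamma s * (Gamma (l + 1 - s))⁻¹‖ ≤ C * (1 + |s.im|) ^ (2 * γ - (l + 1)) := by
  set a : ℝ := ((l : ℝ) + 1) / 2 with ha
  have ha0 : 0 < a := by positivity
  -- On the symmetric line Re s = a the denominator is Γ at the conjugate of s, so the quotient has
  -- modulus 1. Each unit shift to the right multiplies it by the quadratic factor (s - 1)(l - (s -
  -- 1)). Convexity between the exponents 0 at a and 2N at a + N then gives 2(γ - a) at γ, which
  -- avoids Stirling's formula.
  have hstep : ∀ N : ℕ, ∃ C, ∀ s : ℂ, s.re = a + N →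
      ‖Gamma s * (Gamma (l + 1 - s))⁻¹‖ ≤ C * (1 + |s.im|) ^ (2 * N) := by
    intro N
    induction N with
    | zero =>
      refine ⟨1, fun s hs => ?_⟩
      have h1 : (l + 1 - s : ℂ) = (starRingEnd ℂ) s := by
        apply Complex.ext
        · simp [hs, ha]; ring
        · simp
      have h2 : Gamma s ≠ 0 := Gamma_ne_zero_of_re_pos (by rw [hs]; simpa using ha0)
      rw [h1, Gamma_conj, norm_mul, norm_inv, RCLike.norm_conj, mul_inv_cancel₀ (norm_ne_zero_iff.2 h2)]
      simp
    | succ N ih =>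
      obtain ⟨C, hC⟩ := ih
      refine ⟨(a + N + 1) * (a + N + l + 1) * C, fun s hs => ?_⟩
      have h1 := hC (s - 1) (by push_cast at hs; simp [hs]; ring)
      have h2 : (s - 1).re = a + N := by push_cast at hs; simp [hs]; ring
      have h3 : s - 1 ≠ 0 := by
        intro h0; rw [h0] at h2; simp at h2
        have : (0 : ℝ) ≤ N := N.cast_nonneg
        linarith
      have h4 : Gamma s = (s - 1) * Gamma (s - 1) := by
        rw [← Gamma_add_one _ h3]; ring_nf
      have h5 : (Gamma (l + 1 - s))⁻¹ = (l - (s - 1)) * (Gamma (l + 1 - (s - 1)))⁻¹ := by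
        rw [one_div_Gamma_eq_self_mul_one_div_Gamma_add_one]; ring_nf
      have h6 : (s - 1).im = s.im := by simp
      have habs : |(s - 1).re| ≤ a + N := by rw [h2, abs_of_nonneg (by positivity)]
      have h7 := norm_sub_le_mul_one_add_abs_im (s - 1) habs 0
      have h8 := norm_sub_le_mul_one_add_abs_im (s - 1) habs l
      rw [sub_zero, norm_zero, add_zero, h6] at h7
      rw [norm_sub_rev, Complex.norm_natCast, h6] at h8
      rw [h6] at h1
      calc ‖Gamma s * (Gamma (l + 1 - s))⁻¹‖
          = ‖s - 1‖ * ‖(l : ℂ) - (s - 1)‖ * ‖Gamma (s - 1) * (Gamma (l + 1 - (s - 1)))⁻¹‖ := by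
            rw [h4, h5]; simp only [norm_mul]; ring
        _ ≤ ((a + N + 1) * (1 + |s.im|)) * ((a + N + l + 1) * (1 + |s.im|)) *
              (C * (1 + |s.im|) ^ (2 * N)) := by gcongr
        _ = _ := by ring
  obtain ⟨N, hN⟩ := exists_nat_gt (γ - a)
  obtain ⟨C₀, h₀⟩ := hstep 0
  obtain ⟨C₁, h₁⟩ := hstep N
  have hab : a < a + N := by linarith
  have hcont : ContinuousOn Real.Gamma (Icc a (a + N)) := fun x hx =>
    (Real.differentiableAt_Gamma fun m => by
      have := hx.1
      have hm : (0 : ℝ) ≤ m := m.cast_nonneg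
      intro h
      linarith).continuousAt.continuousWithinAt
  obtain ⟨M, hM⟩ := isCompact_Icc.exists_bound_of_continuousOn hcont
  obtain ⟨C₂, h₂⟩ := exists_norm_inv_Gamma_le ((l : ℝ) + 1 - (a + N)) ((l : ℝ) + 1 - a)
  have hmain := exists_norm_le_rpow_of_verticalStrip (α := 0) (β := 2 * N)
    (F := fun s => Gamma s * (Gamma (l + 1 - s))⁻¹)
    (A := π) (B := M * C₂) (C := |C₀| + |C₁|) hab ?_ ?_ ?_ ?_
  · obtain ⟨C', hC'⟩ := hmain
    refine ⟨C', fun s hs => ?_⟩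
    have h3 := hC' s (by rw [hs]; exact hγ) (by rw [hs]; linarith)
    convert h3 using 3
    have hN0 : (N : ℝ) ≠ 0 := by
      have : (0 : ℝ) < N := by linarith
      exact this.ne'
    rw [hs]
    field_simp
    rw [ha]
    field_simp
    ring
  · refine DifferentiableOn.diffContOnCl fun s hs => ?_
    have h3 := closure_verticalStrip_subset hs
    have h4 : 0 < s.re := ha0.trans_le h3.1
    refine (DifferentiableAt.mul (differentiableAt_Gamma s fun m hm => ?_) ?_).differentiableWithinAt
    · rw [hm] at h4; simp at h4
      have : (0 : ℝ) ≤ m := m.cast_nonneg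
      linarith
    · exact (differentiable_one_div_Gamma.comp
        (by fun_prop : Differentiable ℂ fun s : ℂ => (l : ℂ) + 1 - s)) s
  · intro s hs1 hs2
    have h3 : ‖Gamma s‖ ≤ M := (norm_Gamma_le_Gamma_re (ha0.trans_le hs1)).trans
      ((le_abs_self _).trans (hM _ ⟨hs1, hs2⟩))
    have h4 := h₂ (l + 1 - s) (by simp; linarith) (by simp; linarith)
    have h5 : |(l + 1 - s : ℂ).im| = |s.im| := by simp
    rw [h5] at h4
    rw [norm_mul, mul_assoc]
    exact mul_le_mul h3 h4 (norm_nonneg _) ((norm_nonneg _).trans h3)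
  · intro s hs
    have := h₀ s (by simpa using hs)
    refine this.trans ?_
    rw [Real.rpow_zero, mul_zero, pow_zero, mul_one, mul_one]
    linarith [le_abs_self C₀, abs_nonneg C₁]
  · intro s hs
    refine (h₁ s hs).trans ?_
    rw [← Real.rpow_natCast]
    push_cast
    gcongr
    linarith [le_abs_self C₁, abs_nonneg C₀]

theorem exists_norm_riemannZeta_le {σ : ℝ} (hσ : 1 < σ) :
    ∃ C, ∀ s : ℂ, σ ≤ s.re → ‖riemannZeta s‖ ≤ C := by
  refine ⟨∑' n : ℕ, 1 / (n : ℝ) ^ σ, fun s hs => ?_⟩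
  rw [zeta_eq_tsum_one_div_nat_cpow (hσ.trans_le hs)]
  have hsum := Real.summable_one_div_nat_rpow.2 hσ
  refine tsum_of_norm_bounded hsum.hasSum fun n => ?_
  rcases Nat.eq_zero_or_pos n with rfl | hn
  · have h0 : s ≠ 0 := by rintro rfl; simp at hs; linarith
    simp [h0, (zero_lt_one.trans hσ).ne']
  · rw [norm_div, norm_one, Complex.norm_natCast_cpow_of_pos hn]
    have : (1 : ℝ) ≤ n := by exact_mod_cast hn
    gcongr

theorem exists_norm_divisorPhi_le (l : ℕ) {σ : ℝ} (hσ : (l : ℝ) + 1 < σ) :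
    ∃ C, ∀ s : ℂ, σ ≤ s.re → ‖divisorPhi l s‖ ≤ C := by
  have hl : (0 : ℝ) ≤ l := l.cast_nonneg
  obtain ⟨C₁, h₁⟩ := exists_norm_riemannZeta_le (σ := σ) (by linarith)
  obtain ⟨C₂, h₂⟩ := exists_norm_riemannZeta_le (σ := σ - l) (by linarith)
  refine ⟨C₁ * C₂, fun s hs => ?_⟩
  rw [divisorPhi, norm_mul]
  exact mul_le_mul (h₁ s hs) (h₂ _ (by simp; linarith)) (norm_nonneg _)
    ((norm_nonneg _).trans (h₁ s hs))

/-- The functional equation relating `φ(l + 1 - s)` and `φ(s)`. -/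
theorem divisorPhi_one_add_sub {l : ℕ} (hl : Odd l) {s : ℂ} (hs : (l : ℝ) + 1 < s.re) :
    divisorPhi l (l + 1 - s) = (2 * π : ℂ) ^ (l + 1 - 2 * s) * (-1) ^ ((l + 1) / 2) *
      (Gamma s * (Gamma (l + 1 - s))⁻¹) * divisorPhi l s := by
  have hl0 : (0 : ℝ) ≤ l := l.cast_nonneg
  have hpi : (2 * π : ℂ) ≠ 0 := by simp [Real.pi_ne_zero]
  have hne : ∀ (z : ℂ), 1 < z.re → (∀ n : ℕ, z ≠ -n) ∧ z ≠ 1 := by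
    intro z hz
    refine ⟨fun n h => ?_, fun h => ?_⟩
    · rw [h] at hz; simp at hz
      have : (0 : ℝ) ≤ n := n.cast_nonneg
      linarith
    · rw [h] at hz; simp at hz
  obtain ⟨h1, h2⟩ := hne s (by linarith)
  obtain ⟨h3, h4⟩ := hne (s - l) (by simp; linarith)
  have e1 := riemannZeta_one_sub h1 h2
  have e2 := riemannZeta_one_sub h3 h4
  have e3 : (l + 1 - s : ℂ) = 1 - (s - l) := by ring
  have e4 : (l + 1 - s - l : ℂ) = 1 - s := by ring
  rw [divisorPhi, divisorPhi, e4, e3, e1, e2]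
  obtain ⟨m, rfl⟩ := hl
  have e5 : (2 * m + 1 + 1) / 2 = m + 1 := by omega
  rw [e5]
  -- The parity of l enters here: the two cosines from the functional equations of ζ(s) and ζ(s - l)
  -- become a sine times a cosine, hence half of sin(πs). The reflection formula for Γ(s - l) then
  -- converts this into 1/Γ(l + 1 - s).
  have hcos : cos (π * (s - (2 * m + 1 : ℕ)) / 2) = (-1) ^ m * sin (π * s / 2) := by
    have : (π * (s - (2 * m + 1 : ℕ)) / 2 : ℂ) = π * s / 2 - π / 2 - m * π := by push_cast; ring
    rw [this, Complex.cos_antiperiodic.sub_nat_mul_eq, cos_sub_pi_div_two]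
  have hrefl := Gamma_mul_Gamma_one_sub (s - (2 * m + 1 : ℕ))
  have hsin : sin (π * (s - (2 * m + 1 : ℕ))) = -sin (π * s) := by
    have : (π * (s - (2 * m + 1 : ℕ)) : ℂ) = π * s - (2 * m + 1 : ℕ) * π := by push_cast; ring
    rw [this, Complex.sin_antiperiodic.sub_nat_mul_eq]
    rw [Odd.neg_one_pow ⟨m, rfl⟩]; ring
  have hsin2 : sin (π * s) = 2 * sin (π * s / 2) * cos (π * s / 2) := by
    rw [← sin_two_mul]; ring_nf
  rw [hsin] at hrefl
  have hG1 : Gamma (s - (2 * m + 1 : ℕ)) ≠ 0 := Gamma_ne_zero h3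
  have key : 2 * sin (π * s / 2) * cos (π * s / 2) * Gamma (s - (2 * m + 1 : ℕ)) =
      -π * (Gamma (1 - (s - (2 * m + 1 : ℕ))))⁻¹ := by
    rw [← hsin2]
    by_cases hz : sin (π * s) = 0
    · rw [hz, neg_zero, div_zero] at hrefl
      rw [(mul_eq_zero.1 hrefl).resolve_left hG1, hz]; simp
    · have hG2 : Gamma (1 - (s - (2 * m + 1 : ℕ))) ≠ 0 := by
        intro h0; rw [h0, mul_zero] at hrefl
        exact (div_ne_zero (ofReal_ne_zero.2 Real.pi_ne_zero) (neg_ne_zero.2 hz)) hrefl.symm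
      rw [eq_div_iff (neg_ne_zero.2 hz)] at hrefl
      field_simp
      linear_combination -hrefl
  have hpow : (2 * π : ℂ) ^ (-(s - (2 * m + 1 : ℕ))) * (2 * π : ℂ) ^ (-s) * (2 * π) =
      (2 * π : ℂ) ^ ((2 * m + 1 : ℕ) + 1 - 2 * s) := by
    rw [← cpow_add _ _ hpi]
    have : ((2 * m + 1 : ℕ) + 1 - 2 * s : ℂ) = (-(s - (2 * m + 1 : ℕ)) + -s) + 1 := by ring
    rw [this, cpow_add _ 1 hpi, cpow_one]
  rw [hcos, ← hpow]
  linear_combination (2 * (-1) ^ m * (2 * π : ℂ) ^ (-(s - (2 * m + 1 : ℕ))) * (2 * π : ℂ) ^ (-s) *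
    Gamma s * riemannZeta s * riemannZeta (s - (2 * m + 1 : ℕ))) * key

/-- The entire function `(s - 1) (s - l - 1) φ(s)`. -/
noncomputable def divisorEntire (l : ℕ) (s : ℂ) : ℂ := zetaEntire s * zetaEntire (s - l)

theorem differentiable_divisorEntire (l : ℕ) : Differentiable ℂ (divisorEntire l) :=
  differentiable_zetaEntire.mul
    (differentiable_zetaEntire.comp (differentiable_id.sub_const (l : ℂ)))

theorem divisorEntire_eq {l : ℕ} {s : ℂ} (h1 : s ≠ 1) (hl : s ≠ l + 1) :
    divisorEntire l s = (s - 1) * (s - l - 1) * divisorPhi l s := by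
  rw [divisorEntire, divisorPhi, zetaEntire_eq h1, zetaEntire_eq]
  · ring
  · intro h; exact hl (by linear_combination h)

theorem divisorEntire_one {l : ℕ} (hl : l ≠ 0) :
    divisorEntire l 1 = -l * riemannZeta (1 - l) := by
  rw [divisorEntire, zetaEntire_one, zetaEntire_eq (by simpa using hl)]; ring

theorem divisorEntire_add_one {l : ℕ} (hl : l ≠ 0) :
    divisorEntire l (l + 1) = l * riemannZeta (1 + l) := by
  rw [divisorEntire, add_sub_cancel_left, zetaEntire_one, zetaEntire_eq (by simpa using hl),
    add_comm (l : ℂ)]; ring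

/-- Convexity with the same exponent on both edges. On the right φ is bounded; on the left the
functional equation moves the point to Re = γ and costs 2γ - (l + 1) ≤ k. The extra 2 comes from the
factors that remove the poles. -/
theorem exists_norm_divisorEntire_le {l k : ℕ} (hl : Odd l) {γ b : ℝ} (hγ : (l : ℝ) + 1 < γ)
    (hγk : 2 * γ - (l + 1) ≤ k) (hb : (l : ℝ) + 1 < b) :
    ∃ C, ∀ s : ℂ, l + 1 - γ ≤ s.re → s.re ≤ b →
      ‖divisorEntire l s‖ ≤ C * (1 + |s.im|) ^ (k + 2) := by
  have hl0 : (0 : ℝ) ≤ l := l.cast_nonneg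
  obtain ⟨CQ, hQ⟩ := exists_norm_Gamma_div_Gamma_le l (γ := γ) (by linarith)
  obtain ⟨Cγ, hCγ⟩ := exists_norm_divisorPhi_le l hγ
  obtain ⟨Cb, hCb⟩ := exists_norm_divisorPhi_le l hb
  obtain ⟨B₁, A₁, h₁⟩ := exists_norm_zetaEntire_le (l + 1 - γ) b
  obtain ⟨B₂, A₂, h₂⟩ := exists_norm_zetaEntire_le (l + 1 - γ - l) (b - l)
  have hfac : ∀ s : ℂ, |s.re| ≤ γ + b → ‖(s - 1) * (s - l - 1)‖ ≤
      (γ + b + l + 2) ^ 2 * (1 + |s.im|) ^ 2 := by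
    intro s hs
    have h3 := norm_sub_le_mul_one_add_abs_im s hs 1
    have h4 := norm_sub_le_mul_one_add_abs_im s hs ((l + 1 : ℕ) : ℂ)
    rw [norm_one] at h3
    rw [Complex.norm_natCast] at h4
    have e : (s - l - 1 : ℂ) = s - ((l + 1 : ℕ) : ℂ) := by push_cast; ring
    rw [norm_mul, e, ← mul_pow, pow_two]
    refine mul_le_mul (h3.trans ?_) (h4.trans ?_) (norm_nonneg _) ?_
    · gcongr ?_ * _; linarith
    · push_cast; gcongr ?_ * _; linarith
    · exact mul_nonneg (by linarith) (by positivity)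
  set K := (γ + b + l + 2) ^ 2 with hK
  set CL := (2 * π) ^ (2 * γ - (l + 1)) * |CQ| * |Cγ| with hCL
  have hCL0 : 0 ≤ CL := by positivity
  have hmain := exists_norm_le_rpow_of_verticalStrip (α := (k + 2 : ℕ)) (β := (k + 2 : ℕ))
    (F := divisorEntire l) (a := l + 1 - γ) (b := b)
    (A := A₁ + A₂) (B := B₁ * B₂) (C := K * (CL + |Cb|)) (by linarith)
    (differentiable_divisorEntire l).diffContOnCl ?_ ?_ ?_
  · obtain ⟨C', hC'⟩ := hmain
    refine ⟨C', fun s hs1 hs2 => ?_⟩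
    have := hC' s hs1 hs2
    rwa [sub_self, zero_mul, add_zero, Real.rpow_natCast] at this
  · intro s hs1 hs2
    have h3 := h₁ s hs1 hs2
    have h4 := h₂ (s - l) (by simp; linarith) (by simp; linarith)
    have h5 : (s - l : ℂ).im = s.im := by simp
    rw [h5] at h4
    rw [divisorEntire, norm_mul, add_mul, Real.exp_add]
    calc _ ≤ (B₁ * Real.exp (A₁ * |s.im|)) * (B₂ * Real.exp (A₂ * |s.im|)) :=
          mul_le_mul h3 h4 (norm_nonneg _) ((norm_nonneg _).trans h3)
      _ = _ := by ring
  · intro s hs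
    have hre : (l + 1 - s : ℂ).re = γ := by simp [hs]
    have him : |(l + 1 - s : ℂ).im| = |s.im| := by simp
    have hfe := divisorPhi_one_add_sub hl (s := l + 1 - s) (by rw [hre]; exact hγ)
    rw [sub_sub_cancel] at hfe
    have h1 : s ≠ 1 := by rintro rfl; simp at hs; linarith
    have h2 : s ≠ l + 1 := by rintro rfl; simp at hs; linarith
    have hphi : ‖divisorPhi l s‖ ≤ CL * (1 + |s.im|) ^ k := by
      rw [hfe, norm_mul, norm_mul, norm_mul, norm_pow, norm_neg, norm_one, one_pow, mul_one]
      have h5 : ‖(2 * π : ℂ) ^ (l + 1 - 2 * (l + 1 - s))‖ = (2 * π) ^ (l + 1 - 2 * γ) := by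
        have : (2 * π : ℂ) = ((2 * π : ℝ) : ℂ) := by push_cast; ring
        rw [this, norm_cpow_eq_rpow_re_of_pos (by positivity)]
        simp [hs]
      have h6 : (2 * π) ^ (l + 1 - 2 * γ) ≤ (2 * π) ^ (2 * γ - (l + 1)) :=
        Real.rpow_le_rpow_of_exponent_le (by linarith [Real.pi_gt_three]) (by linarith)
      have h7 := hQ _ hre
      rw [sub_sub_cancel, him] at h7
      have h8 : (1 + |s.im|) ^ (2 * γ - (l + 1)) ≤ (1 + |s.im|) ^ k := by
        rw [← Real.rpow_natCast]
        exact Real.rpow_le_rpow_of_exponent_le (by linarith [abs_nonneg s.im]) hγk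
      have h9 := hCγ _ hre.ge
      rw [h5]
      calc _ ≤ (2 * π) ^ (2 * γ - (l + 1)) * (|CQ| * (1 + |s.im|) ^ k) * |Cγ| := by
            gcongr
            · refine h7.trans ?_
              gcongr
              exact le_abs_self _
            · exact h9.trans (le_abs_self _)
        _ = _ := by rw [hCL]; ring
    rw [divisorEntire_eq h1 h2, norm_mul, Real.rpow_natCast]
    calc _ ≤ (K * (1 + |s.im|) ^ 2) * (CL * (1 + |s.im|) ^ k) := by
          gcongr
          refine hfac s (abs_le.2 ⟨by rw [hs]; linarith, by rw [hs]; linarith⟩)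
      _ = K * CL * (1 + |s.im|) ^ (k + 2) := by ring
      _ ≤ _ := by gcongr; linarith [abs_nonneg Cb]
  · intro s hs
    have h1 : s ≠ 1 := by rintro rfl; simp at hs; linarith
    have h2 : s ≠ l + 1 := by rintro rfl; simp at hs; linarith
    rw [divisorEntire_eq h1 h2, norm_mul, Real.rpow_natCast]
    calc _ ≤ (K * (1 + |s.im|) ^ 2) * |Cb| := by
          gcongr
          · refine hfac s (abs_le.2 ⟨by rw [hs]; linarith, by rw [hs]; linarith⟩)
          · exact (hCb s hs.ge).trans (le_abs_self _)
      _ = K * |Cb| * (1 + |s.im|) ^ 2 := by ring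
      _ ≤ _ := by
          gcongr
          · linarith
          · linarith [abs_nonneg s.im]
          · omega

/-! ### Riesz means and their derivatives -/

theorem contDiffOn_of_hasDerivAt_succ {f : ℕ → ℝ → ℂ} {U : Set ℝ} (hU : IsOpen U)
    (h0 : ContinuousOn (f 0) U) (n : ℕ)
    (hd : ∀ m < n, ∀ x ∈ U, HasDerivAt (f (m + 1)) (f m x) x) :
    ContDiffOn ℝ n (f n) U ∧ ∀ x ∈ U, iteratedDeriv n (f n) x = f 0 x := by
  induction n with
  | zero => exact ⟨contDiffOn_zero.2 h0, fun x _ => by simp⟩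
  | succ n ih =>
    obtain ⟨h1, h2⟩ := ih fun m hm => hd m (by omega)
    have h3 := hd n (by omega)
    have h4 : EqOn (deriv (f (n + 1))) (f n) U := fun x hx => (h3 x hx).deriv
    refine ⟨?_, fun x hx => ?_⟩
    · push_cast
      rw [contDiffOn_succ_iff_deriv_of_isOpen hU]
      exact ⟨fun x hx => (h3 x hx).differentiableAt.differentiableWithinAt, by simp, h1.congr h4⟩
    · rw [iteratedDeriv_succ', ← h2 x hx]
      exact (h4.eventuallyEq_of_mem (hU.mem_nhds hx)).iteratedDeriv_eq n

/-- The polynomial `w (w + 1) ⋯ (w + m)`. -/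
noncomputable def risingProd (m : ℕ) (w : ℂ) : ℂ := ∏ j ∈ Finset.range (m + 1), (w + j)

theorem risingProd_succ (m : ℕ) (w : ℂ) :
    risingProd (m + 1) w = risingProd m w * (w + (m + 1 : ℕ)) := by
  rw [risingProd, Finset.prod_range_succ, risingProd]

theorem continuous_risingProd (m : ℕ) : Continuous (risingProd m) := by
  unfold risingProd; fun_prop

theorem differentiable_risingProd (m : ℕ) : Differentiable ℂ (risingProd m) := by
  unfold risingProd; fun_prop

theorem risingProd_ne_zero {m : ℕ} {w : ℂ} (h : ∀ j : ℕ, j ≤ m → w + j ≠ 0) :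
    risingProd m w ≠ 0 :=
  Finset.prod_ne_zero_iff.2 fun j hj => h j (by simpa [Nat.lt_succ_iff] using hj)

/-- The integral `∫ H(t) x ^ (w(t) + m) / (w(t) (w(t) + 1) ⋯ (w(t) + m)) dμ(t)`. -/
noncomputable def rieszIntegral (μ : Measure ℝ) (H w : ℝ → ℂ) (m : ℕ) (x : ℝ) : ℂ :=
  ∫ t, H t / risingProd m (w t) * (x : ℂ) ^ (w t + m) ∂μ

theorem exists_rpow_le_of_mem_Icc {p q : ℝ} (hp : 0 < p) (A B : ℝ) :
    ∃ M, ∀ y ∈ Icc p q, ∀ r ∈ Icc A B, y ^ r ≤ M := by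
  have hc : ContinuousOn (fun z : ℝ × ℝ => z.1 ^ z.2) (Icc p q ×ˢ Icc A B) :=
    continuousOn_fst.rpow continuousOn_snd fun z hz => Or.inl (hp.trans_le hz.1.1).ne'
  obtain ⟨M, hM⟩ := (isCompact_Icc.prod isCompact_Icc).exists_bound_of_continuousOn hc
  exact ⟨M, fun y hy r hr => (le_abs_self _).trans (hM (y, r) ⟨hy, hr⟩)⟩

section rieszIntegral

variable {μ : Measure ℝ} {H w : ℝ → ℂ} {A B : ℝ}

theorem aestronglyMeasurable_rieszIntegrand {m : ℕ} (hw : Continuous w)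
    (hI : Integrable (fun t => H t / risingProd m (w t)) μ) {x : ℝ} (hx : 0 < x) :
    AEStronglyMeasurable (fun t => H t / risingProd m (w t) * (x : ℂ) ^ (w t + m)) μ := by
  refine hI.aestronglyMeasurable.mul (Continuous.aestronglyMeasurable ?_)
  exact (hw.add continuous_const).const_cpow (Or.inl (ofReal_ne_zero.2 hx.ne'))

theorem integrable_rieszIntegrand {m : ℕ} (hw : Continuous w)
    (hAB : ∀ᵐ t ∂μ, (w t).re ∈ Icc A B)
    (hI : Integrable (fun t => H t / risingProd m (w t)) μ) {x : ℝ} (hx : 0 < x) :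
    Integrable (fun t => H t / risingProd m (w t) * (x : ℂ) ^ (w t + m)) μ := by
  obtain ⟨M, hM⟩ := exists_rpow_le_of_mem_Icc (q := x) hx (A + m) (B + m)
  refine (hI.norm.mul_const M).mono' (aestronglyMeasurable_rieszIntegrand hw hI hx) ?_
  filter_upwards [hAB] with t ht
  rw [norm_mul, norm_cpow_eq_rpow_re_of_pos hx]
  gcongr
  exact hM x ⟨le_rfl, le_rfl⟩ _ ⟨by simpa using ht.1, by simpa using ht.2⟩

theorem continuousOn_rieszIntegral {m : ℕ} (hw : Continuous w)
    (hAB : ∀ᵐ t ∂μ, (w t).re ∈ Icc A B)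
    (hI : Integrable (fun t => H t / risingProd m (w t)) μ) :
    ContinuousOn (rieszIntegral μ H w m) (Ioi 0) := by
  intro x (hx : 0 < x)
  refine ContinuousAt.continuousWithinAt ?_
  obtain ⟨M, hM⟩ := exists_rpow_le_of_mem_Icc (p := x / 2) (q := 2 * x) (by positivity)
    (A + m) (B + m)
  have hnhds : ∀ᶠ y in 𝓝 x, y ∈ Icc (x / 2) (2 * x) :=
    Icc_mem_nhds (by linarith) (by linarith)
  refine continuousAt_of_dominated (bound := fun t => ‖H t / risingProd m (w t)‖ * M) ?_ ?_
    (hI.norm.mul_const M) ?_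
  · filter_upwards [hnhds] with y hy
    exact aestronglyMeasurable_rieszIntegrand hw hI (by linarith [hy.1])
  · filter_upwards [hnhds] with y hy
    filter_upwards [hAB] with t ht
    rw [norm_mul, norm_cpow_eq_rpow_re_of_pos (by linarith [hy.1])]
    gcongr
    exact hM y hy _ ⟨by simpa using ht.1, by simpa using ht.2⟩
  · refine .of_forall fun t => ?_
    refine continuousAt_const.mul ?_
    exact (continuous_ofReal.continuousAt).cpow continuousAt_const (by simp [hx])

/-- Differentiating x^(w+m+1) produces exactly the last factor of the rising product, so the order
drops by one. Near x the powers are bounded uniformly because Re w stays in a bounded interval; this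
gives the domination. -/
theorem hasDerivAt_rieszIntegral {m : ℕ} (hw : Continuous w)
    (hAB : ∀ᵐ t ∂μ, (w t).re ∈ Icc A B)
    (hne : ∀ᵐ t ∂μ, w t + (m + 1 : ℕ) ≠ 0)
    (hI : Integrable (fun t => H t / risingProd m (w t)) μ)
    (hI' : Integrable (fun t => H t / risingProd (m + 1) (w t)) μ) {x : ℝ} (hx : 0 < x) :
    HasDerivAt (rieszIntegral μ H w (m + 1)) (rieszIntegral μ H w m x) x := by
  obtain ⟨M, hM⟩ := exists_rpow_le_of_mem_Icc (p := x / 2) (q := 2 * x) (by positivity)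
    (A + m) (B + m)
  have hnhds : Ioo (x / 2) (2 * x) ∈ 𝓝 x := Ioo_mem_nhds (by linarith) (by linarith)
  refine (hasDerivAt_integral_of_dominated_loc_of_deriv_le
    (F' := fun x t => H t / risingProd m (w t) * (x : ℂ) ^ (w t + m))
    (bound := fun t => ‖H t / risingProd m (w t)‖ * M) hnhds ?_
    (integrable_rieszIntegrand hw hAB hI' hx) (aestronglyMeasurable_rieszIntegrand hw hI hx) ?_
    (hI.norm.mul_const M) ?_).2
  · filter_upwards [hnhds] with y hy
    exact aestronglyMeasurable_rieszIntegrand hw hI' (by linarith [hy.1])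
  · filter_upwards [hAB] with t ht y hy
    rw [norm_mul, norm_cpow_eq_rpow_re_of_pos (by linarith [hy.1])]
    gcongr
    exact hM y ⟨hy.1.le, hy.2.le⟩ _ ⟨by simpa using ht.1, by simpa using ht.2⟩
  · filter_upwards [hne] with t ht y hy
    have hy0 : 0 < y := by linarith [hy.1]
    have h1 := (hasDerivAt_ofReal_cpow_const' hy0.ne' (r := w t + m) (by
      intro h
      apply ht
      push_cast
      linear_combination h)).const_mul (H t / risingProd (m + 1) (w t) * (w t + m + 1))
    rw [risingProd_succ] at h1 ⊢
    push_cast at ht h1 ⊢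
    simp only [← add_assoc] at ht h1 ⊢
    refine (h1.congr_deriv ?_).congr_of_eventuallyEq (.of_forall fun z => ?_)
    · field_simp
    · simp only
      field_simp

theorem contDiffOn_rieszIntegral (hw : Continuous w)
    (hAB : ∀ᵐ t ∂μ, (w t).re ∈ Icc A B) (m n : ℕ)
    (hne : ∀ᵐ t ∂μ, ∀ j : ℕ, j ≤ m + n → w t + j ≠ 0)
    (hI : ∀ i, m ≤ i → i ≤ m + n → Integrable (fun t => H t / risingProd i (w t)) μ) :
    ContDiffOn ℝ n (rieszIntegral μ H w (m + n)) (Ioi 0) ∧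
      ∀ x > 0, iteratedDeriv n (rieszIntegral μ H w (m + n)) x = rieszIntegral μ H w m x := by
  refine contDiffOn_of_hasDerivAt_succ (f := fun i => rieszIntegral μ H w (m + i)) isOpen_Ioi
    (continuousOn_rieszIntegral hw hAB (hI m le_rfl (by omega))) n fun i hi x hx => ?_
  exact hasDerivAt_rieszIntegral hw hAB (hne.mono fun t ht => ht _ (by omega))
    (hI _ (by omega) (by omega)) (hI (m + i + 1) (by omega) (by omega)) hx

end rieszIntegral

/-! ### Rectangular contours and residues -/

/-- The integral of `f` along the boundary of the rectangle `[a, b] × [c, d]`. -/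
noncomputable def rectIntegral (f : ℂ → ℂ) (a b c d : ℝ) : ℂ :=
  (∫ x in a..b, f (x + c * I)) - (∫ x in a..b, f (x + d * I)) +
    I * (∫ y in c..d, f (b + y * I)) - I * ∫ y in c..d, f (a + y * I)

theorem rectIntegral_eq_zero {f : ℂ → ℂ} {a b c d : ℝ} (hab : a ≤ b) (hcd : c ≤ d)
    (hf : DifferentiableOn ℂ f (Icc a b ×ℂ Icc c d)) : rectIntegral f a b c d = 0 := by
  have := integral_boundary_rect_eq_zero_of_differentiableOn f ⟨a, c⟩ ⟨b, d⟩
    (by simpa [uIcc_of_le hab, uIcc_of_le hcd] using hf)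
  simpa [rectIntegral] using this

/-- The boundary of the rectangle `[a, b] × [c, d]`. -/
def rectFrame (a b c d : ℝ) : Set ℂ :=
  {z | z.re ∈ Icc a b ∧ z.im ∈ Icc c d ∧ (z.re = a ∨ z.re = b ∨ z.im = c ∨ z.im = d)}

theorem rectFrame_subset {a b c d : ℝ} : rectFrame a b c d ⊆ Icc a b ×ℂ Icc c d :=
  fun _ hz => ⟨hz.1, hz.2.1⟩

section rectFrame

variable {f g : ℂ → ℂ} {a b c d : ℝ}

theorem mem_rectFrame_bottom (hcd : c ≤ d) {x : ℝ} (hx : x ∈ uIcc a b) (hab : a ≤ b) :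
    (x + c * I : ℂ) ∈ rectFrame a b c d := by
  rw [uIcc_of_le hab] at hx
  simp [rectFrame, hx.1, hx.2, hcd]

theorem mem_rectFrame_top (hcd : c ≤ d) {x : ℝ} (hx : x ∈ uIcc a b) (hab : a ≤ b) :
    (x + d * I : ℂ) ∈ rectFrame a b c d := by
  rw [uIcc_of_le hab] at hx
  simp [rectFrame, hx.1, hx.2, hcd]

theorem mem_rectFrame_left (hcd : c ≤ d) {y : ℝ} (hy : y ∈ uIcc c d) (hab : a ≤ b) :
    (a + y * I : ℂ) ∈ rectFrame a b c d := by
  rw [uIcc_of_le hcd] at hy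
  simp [rectFrame, hy.1, hy.2, hab]

theorem mem_rectFrame_right (hcd : c ≤ d) {y : ℝ} (hy : y ∈ uIcc c d) (hab : a ≤ b) :
    (b + y * I : ℂ) ∈ rectFrame a b c d := by
  rw [uIcc_of_le hcd] at hy
  simp [rectFrame, hy.1, hy.2, hab]

theorem intervalIntegrable_of_rectFrame (hab : a ≤ b) (hcd : c ≤ d)
    (hf : ContinuousOn f (rectFrame a b c d)) :
    IntervalIntegrable (fun x : ℝ => f (x + c * I)) volume a b ∧
    IntervalIntegrable (fun x : ℝ => f (x + d * I)) volume a b ∧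
    IntervalIntegrable (fun y : ℝ => f (b + y * I)) volume c d ∧
    IntervalIntegrable (fun y : ℝ => f (a + y * I)) volume c d := by
  refine ⟨ContinuousOn.intervalIntegrable ?_, ContinuousOn.intervalIntegrable ?_,
    ContinuousOn.intervalIntegrable ?_, ContinuousOn.intervalIntegrable ?_⟩
  · exact hf.comp (by fun_prop) fun x hx => mem_rectFrame_bottom hcd hx hab
  · exact hf.comp (by fun_prop) fun x hx => mem_rectFrame_top hcd hx hab
  · exact hf.comp (by fun_prop) fun x hx => mem_rectFrame_right hcd hx hab
  · exact hf.comp (by fun_prop) fun x hx => mem_rectFrame_left hcd hx hab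

theorem rectIntegral_congr (hab : a ≤ b) (hcd : c ≤ d) (h : EqOn f g (rectFrame a b c d)) :
    rectIntegral f a b c d = rectIntegral g a b c d := by
  unfold rectIntegral
  congr 1; congr 1; congr 1
  · exact intervalIntegral.integral_congr fun x hx => h (mem_rectFrame_bottom hcd hx hab)
  · exact intervalIntegral.integral_congr fun x hx => h (mem_rectFrame_top hcd hx hab)
  · congr 1
    exact intervalIntegral.integral_congr fun x hx => h (mem_rectFrame_right hcd hx hab)
  · congr 1
    exact intervalIntegral.integral_congr fun x hx => h (mem_rectFrame_left hcd hx hab)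

theorem rectIntegral_add (hab : a ≤ b) (hcd : c ≤ d) (hf : ContinuousOn f (rectFrame a b c d))
    (hg : ContinuousOn g (rectFrame a b c d)) :
    rectIntegral (fun z => f z + g z) a b c d =
      rectIntegral f a b c d + rectIntegral g a b c d := by
  obtain ⟨f1, f2, f3, f4⟩ := intervalIntegrable_of_rectFrame hab hcd hf
  obtain ⟨g1, g2, g3, g4⟩ := intervalIntegrable_of_rectFrame hab hcd hg
  unfold rectIntegral
  rw [intervalIntegral.integral_add f1 g1, intervalIntegral.integral_add f2 g2,
    intervalIntegral.integral_add f3 g3, intervalIntegral.integral_add f4 g4]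
  ring

theorem rectIntegral_const_mul (r : ℂ) :
    rectIntegral (fun z => r * f z) a b c d = r * rectIntegral f a b c d := by
  unfold rectIntegral
  simp only [intervalIntegral.integral_const_mul]
  ring

theorem Complex.log_I_mul_of_re_pos_of_im_neg {z : ℂ} (h1 : 0 < z.re) (h2 : z.im < 0) :
    log (I * z) = π / 2 * I + log z := by
  have hz : z ≠ 0 := by rintro rfl; simp at h1
  rw [log_mul I_ne_zero hz, log_I]
  rw [arg_I]
  have h3 := (arg_neg_iff.2 h2)
  have h4 := abs_lt.1 (abs_arg_lt_pi_div_two_iff.2 (Or.inl h1))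
  constructor <;> linarith [Real.pi_pos]

/-- The constant e rotates the segment off the branch cut; it changes the logarithm but not its
derivative. -/
theorem intervalIntegral_inv_add_mul {r q e : ℂ} {a b : ℝ} (he : e ≠ 0)
    (h : ∀ x ∈ uIcc a b, e * (r + x * q) ∈ slitPlane) :
    ∫ x in a..b, q * (r + x * q)⁻¹ = log (e * (r + b * q)) - log (e * (r + a * q)) := by
  have hder : ∀ x ∈ uIcc a b, HasDerivAt (fun x : ℝ => log (e * (r + x * q)))
      (q * (r + x * q)⁻¹) x := by
    intro x hx
    have h1 : HasDerivAt (fun x : ℝ => e * (r + x * q)) (e * (1 * q)) x :=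
      (((hasDerivAt_id x).ofReal_comp.mul_const q).const_add r).const_mul e
    have h2 := h1.clog_real (h x hx)
    convert h2 using 1
    rw [mul_div_mul_left _ _ he]
    ring
  refine intervalIntegral.integral_eq_sub_of_hasDerivAt hder (ContinuousOn.intervalIntegrable ?_)
  refine continuousOn_const.mul (ContinuousOn.inv₀ (by fun_prop) fun x hx h0 => ?_)
  have := h x hx
  rw [h0, mul_zero] at this
  exact slitPlane_ne_zero this rfl

/-- Rotating the four sides by I, -I, 1 and -1 puts each of them in the right half-plane. At each
corner the two branches of the logarithm differ by iπ/2, and the four jumps add up to 2πi. -/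
theorem rectIntegral_inv_sub {p : ℂ} (h1 : a < p.re) (h2 : p.re < b) (h3 : c < p.im)
    (h4 : p.im < d) : rectIntegral (fun z => (z - p)⁻¹) a b c d = 2 * π * I := by
  have e1 := intervalIntegral_inv_add_mul (r := c * I - p) (q := 1) (e := I) (a := a) (b := b)
    I_ne_zero fun x _ => Or.inl (by simp; linarith)
  have e2 := intervalIntegral_inv_add_mul (r := d * I - p) (q := 1) (e := -I) (a := a) (b := b)
    (neg_ne_zero.2 I_ne_zero) fun x _ => Or.inl (by simp; linarith)
  have e3 := intervalIntegral_inv_add_mul (r := b - p) (q := I) (e := 1) (a := c) (b := d)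
    one_ne_zero fun x _ => Or.inl (by simp; linarith)
  have e4 := intervalIntegral_inv_add_mul (r := a - p) (q := I) (e := -1) (a := c) (b := d)
    (neg_ne_zero.2 one_ne_zero) fun x _ => Or.inl (by simp; linarith)
  rw [intervalIntegral.integral_const_mul] at e1 e2 e3 e4
  rw [one_mul] at e1 e2
  have g1 := log_I_mul_of_re_pos_of_im_neg (z := b - p + c * I) (by simp; linarith)
    (by simp; linarith)
  have g2 := log_I_mul_of_re_pos_of_im_neg (z := -I * (b - p + d * I)) (by simp; linarith)
    (by simp; linarith)
  have g3 := log_I_mul_of_re_pos_of_im_neg (z := -(a - p + d * I)) (by simp; linarith)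
    (by simp; linarith)
  have g4 := log_I_mul_of_re_pos_of_im_neg (z := I * (a - p + c * I)) (by simp; linarith)
    (by simp; linarith)
  have i1 : ∀ x : ℝ, ((x : ℂ) + c * I - p)⁻¹ = (c * I - p + x * 1)⁻¹ := fun x => by ring_nf
  have i2 : ∀ x : ℝ, ((x : ℂ) + d * I - p)⁻¹ = (d * I - p + x * 1)⁻¹ := fun x => by ring_nf
  have i3 : ∀ y : ℝ, ((b : ℂ) + y * I - p)⁻¹ = (b - p + y * I)⁻¹ := fun y => by ring_nf
  have i4 : ∀ y : ℝ, ((a : ℂ) + y * I - p)⁻¹ = (a - p + y * I)⁻¹ := fun y => by ring_nf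
  unfold rectIntegral
  simp only [i1, i2, i3, i4]
  rw [e1, e2, e3, e4]
  have j1 : I * (c * I - p + b * 1) = I * (b - p + c * I) := by ring
  have j2 : I * (c * I - p + a * 1) = I * (a - p + c * I) := by ring
  have j3 : -I * (d * I - p + b * 1) = -I * (b - p + d * I) := by ring
  have j4 : -I * (d * I - p + a * 1) = I * -(a - p + d * I) := by ring
  have j5 : 1 * (b - p + d * I) = I * (-I * (b - p + d * I)) := by
    linear_combination (b - p + d * I) * I_mul_I
  have j6 : 1 * (b - p + c * I) = b - p + c * I := by ring
  have j7 : -1 * (a - p + d * I) = -(a - p + d * I) := by ring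
  have j8 : -1 * (a - p + c * I) = I * (I * (a - p + c * I)) := by
    linear_combination (-(a - p + c * I)) * I_mul_I
  rw [j1, j2, j3, j4, j5, j6, j7, j8, g1, g2, g3, g4]
  ring

/-- On the contour g(z)/(z - p) is the difference quotient of g at p, which extends holomorphically
to the rectangle, plus g(p)/(z - p). -/
theorem rectIntegral_div_sub {p : ℂ} (h1 : a < p.re) (h2 : p.re < b) (h3 : c < p.im)
    (h4 : p.im < d) (hg : DifferentiableOn ℂ g (Icc a b ×ℂ Icc c d)) :
    rectIntegral (fun z => g z / (z - p)) a b c d = 2 * π * I * g p := by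
  have hab := (h1.trans h2).le
  have hcd := (h3.trans h4).le
  have hne : ∀ z ∈ rectFrame a b c d, z - p ≠ 0 := by
    rintro z ⟨-, -, hz⟩ h0
    rw [sub_eq_zero] at h0
    subst h0
    rcases hz with h | h | h | h <;> linarith
  have hnhds : Icc a b ×ℂ Icc c d ∈ 𝓝 p := by
    refine mem_of_superset ((isOpen_Ioo.reProdIm isOpen_Ioo).mem_nhds
      (⟨⟨h1, h2⟩, h3, h4⟩ : p ∈ Ioo a b ×ℂ Ioo c d)) fun z hz => ?_
    exact ⟨Ioo_subset_Icc_self hz.1, Ioo_subset_Icc_self hz.2⟩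
  have hslope := (differentiableOn_dslope hnhds).2 hg
  have e : EqOn (fun z => g z / (z - p)) (fun z => dslope g p z + g p * (z - p)⁻¹)
      (rectFrame a b c d) := by
    intro z hz
    have := hne z hz
    simp only
    rw [dslope_of_ne _ (sub_ne_zero.1 this), slope_def_field]
    field_simp
    ring
  rw [rectIntegral_congr hab hcd e, rectIntegral_add hab hcd
    (hslope.continuousOn.mono rectFrame_subset), rectIntegral_const_mul,
    rectIntegral_inv_sub h1 h2 h3 h4, rectIntegral_eq_zero hab hcd hslope]
  · ring
  · exact continuousOn_const.mul ((continuousOn_id.sub continuousOn_const).inv₀ hne)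

theorem rectIntegral_add_vertical {e : ℝ}
    (hb1 : IntervalIntegrable (fun y : ℝ => f (b + y * I)) volume c d)
    (hb2 : IntervalIntegrable (fun y : ℝ => f (b + y * I)) volume d e)
    (ha1 : IntervalIntegrable (fun y : ℝ => f (a + y * I)) volume c d)
    (ha2 : IntervalIntegrable (fun y : ℝ => f (a + y * I)) volume d e) :
    rectIntegral f a b c d + rectIntegral f a b d e = rectIntegral f a b c e := by
  unfold rectIntegral
  rw [← intervalIntegral.integral_add_adjacent_intervals hb1 hb2,
    ← intervalIntegral.integral_add_adjacent_intervals ha1 ha2]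
  ring

/-- Shifting a vertical line of integration across finitely many singularities. -/
theorem integral_vertical_sub_eq_rectIntegral {T₀ C : ℝ} (hab : a ≤ b) (hT₀ : 0 < T₀)
    (hf : DifferentiableOn ℂ f {z | z.re ∈ Icc a b ∧ T₀ ≤ |z.im|})
    (hbound : ∀ z : ℂ, z.re ∈ Icc a b → T₀ ≤ |z.im| → ‖f z‖ ≤ C / |z.im|)
    (ha : Integrable fun y : ℝ => f (a + y * I)) (hb : Integrable fun y : ℝ => f (b + y * I)) :
    I * (∫ y : ℝ, f (b + y * I)) - I * (∫ y : ℝ, f (a + y * I)) =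
      rectIntegral f a b (-T₀) T₀ := by
  -- All singularities lie below height T₀, so the two outer rectangles contribute nothing. The
  -- horizontal sides at height T are O(1/T), and letting T grow leaves only the vertical lines.
  have hconst : ∀ T ≥ T₀, rectIntegral f a b (-T) T = rectIntegral f a b (-T₀) T₀ := by
    intro T hT
    rw [← rectIntegral_add_vertical (d := T₀) hb.intervalIntegrable hb.intervalIntegrable
      ha.intervalIntegrable ha.intervalIntegrable,
      ← rectIntegral_add_vertical (d := -T₀) hb.intervalIntegrable hb.intervalIntegrable
      ha.intervalIntegrable ha.intervalIntegrable]
    rw [rectIntegral_eq_zero hab (neg_le_neg hT), rectIntegral_eq_zero hab hT]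
    · ring
    · exact hf.mono fun z hz => ⟨hz.1, hz.2.1.trans (le_abs_self _)⟩
    · exact hf.mono fun z hz => ⟨hz.1, (le_neg.1 hz.2.2).trans (neg_le_abs _)⟩
  have hhor : ∀ ε : ℝ, |ε| = 1 →
      Tendsto (fun T : ℝ => ∫ x in a..b, f (x + (ε * T : ℝ) * I)) atTop (𝓝 0) := by
    intro ε hε
    refine squeeze_zero_norm' (a := fun T => C / T * |b - a|) ?_ ?_
    · filter_upwards [eventually_ge_atTop T₀] with T hT
      refine intervalIntegral.norm_integral_le_of_norm_le_const fun x hx => ?_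
      have hTpos : 0 < T := hT₀.trans_le hT
      have h1 : |(x + (ε * T : ℝ) * I : ℂ).im| = T := by
        rw [add_im, im_ofReal_mul, I_im, mul_one, ofReal_im, zero_add, abs_mul, hε, one_mul,
          abs_of_pos hTpos]
      have := hbound (x + (ε * T : ℝ) * I) (by
        rw [uIoc_of_le hab] at hx
        simpa using Ioc_subset_Icc_self hx) (by rw [h1]; exact hT)
      rwa [h1] at this
    · simpa using (tendsto_const_nhds.div_atTop tendsto_id).mul_const |b - a|
  have hlim : Tendsto (fun T : ℝ => rectIntegral f a b (-T) T) atTop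
      (𝓝 (0 - 0 + I * (∫ y : ℝ, f (b + y * I)) - I * ∫ y : ℝ, f (a + y * I))) := by
    refine ((Tendsto.sub ?_ ?_).add ?_).sub ?_
    · simpa using hhor (-1) (by simp)
    · simpa using hhor 1 (by simp)
    · exact (intervalIntegral_tendsto_integral hb tendsto_neg_atTop_atBot tendsto_id).const_mul I
    · exact (intervalIntegral_tendsto_integral ha tendsto_neg_atTop_atBot tendsto_id).const_mul I
  have := tendsto_nhds_unique hlim (tendsto_const_nhds.congr' (by
    filter_upwards [eventually_ge_atTop T₀] with T hT using (hconst T hT).symm))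
  rw [← this]; ring

end rectFrame

/-! ### Dirichlet series of the coefficients, and bounds for the rising product -/

theorem LSeries.term_cpow_mul (f : ℕ → ℂ) (a s : ℂ) :
    LSeries.term (fun n => (n : ℂ) ^ a * f n) s = LSeries.term f (s - a) := by
  ext n
  rcases eq_or_ne n 0 with rfl | hn
  · simp
  · have h : (n : ℂ) ≠ 0 := Nat.cast_ne_zero.2 hn
    have h2 : (n : ℂ) ^ a ≠ 0 := by simp [cpow_eq_zero_iff, h]
    rw [LSeries.term_of_ne_zero hn, LSeries.term_of_ne_zero hn, cpow_sub _ _ h]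
    field_simp

theorem LSeriesHasSum_sigma {l : ℕ} {s : ℂ} (hs : (l : ℝ) + 1 < s.re) :
    LSeriesHasSum (fun n => (ArithmeticFunction.sigma l n : ℂ)) s (divisorPhi l s) := by
  have hl : (0 : ℝ) ≤ l := l.cast_nonneg
  have h1 : LSeriesHasSum 1 s (riemannZeta s) := LSeriesHasSum_one (by linarith)
  have h2 : LSeriesHasSum 1 (s - l) (riemannZeta (s - l)) :=
    LSeriesHasSum_one (by simp; linarith)
  have h3 : LSeriesHasSum (fun n => (n : ℂ) ^ (l : ℂ) * (1 : ℕ → ℂ) n) s (riemannZeta (s - l)) := by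
    rw [LSeriesHasSum, LSeries.term_cpow_mul]; exact h2
  have h4 := h3.convolution h1
  rw [mul_comm] at h4
  refine (LSeriesHasSum_congr s _ fun {n} _ => ?_).1 h4
  rw [LSeries.convolution_def, ArithmeticFunction.sigma_apply]
  have := Nat.sum_divisorsAntidiagonal (n := n) fun i j => (i : ℂ) ^ (l : ℂ) * (1 : ℕ → ℂ) i *
    (1 : ℕ → ℂ) j
  simp only [this]
  simp

theorem LSeriesHasSum_divisorConv {l : ℕ} {a s : ℂ} (hs : (l : ℝ) + 1 < s.re)
    (hs' : (l : ℝ) + 1 < (s - a).re) :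
    LSeriesHasSum (divisorConv l a) s (divisorPhi l (s - a) * divisorPhi l s) := by
  have h1 : LSeriesHasSum (fun n => (n : ℂ) ^ a * (ArithmeticFunction.sigma l n : ℂ)) s
      (divisorPhi l (s - a)) := by
    rw [LSeriesHasSum, LSeries.term_cpow_mul]; exact LSeriesHasSum_sigma hs'
  refine (LSeriesHasSum_congr s _ fun {n} _ => ?_).1 (h1.convolution (LSeriesHasSum_sigma hs))
  rw [LSeries.convolution_def]
  exact Nat.sum_divisorsAntidiagonal fun i j => (i : ℂ) ^ a * (ArithmeticFunction.sigma l i : ℂ) *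
    (ArithmeticFunction.sigma l j : ℂ)

theorem exists_pow_le_norm_risingProd {c : ℝ} {m : ℕ} (hc : ∀ j : ℕ, j ≤ m → c + j ≠ 0) :
    ∃ C, 0 < C ∧ ∀ z : ℂ, z.re = c → (1 + |z.im|) ^ (m + 1) ≤ C * ‖risingProd m z‖ := by
  -- Factor by factor: |z + j| is at least |c + j| and at least |Im z|, so 1 + |Im z| ≤ (1/|c + j| +
  -- 1)|z + j|.
  refine ⟨∏ j ∈ Finset.range (m + 1), (1 / |c + j| + 1), Finset.prod_pos fun j _ => by positivity,
    fun z hz => ?_⟩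
  rw [risingProd, norm_prod, ← Finset.prod_mul_distrib, ← Finset.card_range (m + 1),
    ← Finset.prod_const, Finset.card_range]
  refine Finset.prod_le_prod (fun j _ => by positivity) fun j hj => ?_
  have h0 := abs_pos.2 (hc j (by simpa [Nat.lt_succ_iff] using hj))
  have h1 := abs_re_le_norm (z + j)
  have h2 := abs_im_le_norm (z + j)
  simp only [add_re, natCast_re, add_im, natCast_im, add_zero, hz] at h1 h2
  rw [add_mul, one_mul, one_div, inv_mul_eq_div]
  gcongr
  rwa [one_le_div h0]

theorem Complex.Gamma_add_natCast_add_one {m : ℕ} {w : ℂ} (h : ∀ j : ℕ, j ≤ m → w + j ≠ 0) :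
    Gamma (w + m + 1) = risingProd m w * Gamma w := by
  induction m with
  | zero =>
    have h0 := h 0 le_rfl
    rw [Nat.cast_zero, add_zero] at h0 ⊢
    simp [risingProd, Gamma_add_one _ h0]
  | succ m ih =>
    have h1 := h (m + 1) le_rfl
    rw [Gamma_add_one _ h1, risingProd_succ]
    push_cast
    rw [← add_assoc, ih fun j hj => h j (by omega)]
    ring

/-- The function `w ↦ φ(u + w) φ(v - w)`. -/
noncomputable def divisorPair (l : ℕ) (u v w : ℂ) : ℂ := divisorPhi l (u + w) * divisorPhi l (v - w)

theorem differentiableAt_divisorPhi {l : ℕ} {s : ℂ} (h1 : s ≠ 1) (h2 : s ≠ l + 1) :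
    DifferentiableAt ℂ (divisorPhi l) s := by
  refine (differentiableAt_riemannZeta h1).mul ?_
  refine DifferentiableAt.comp s (g := riemannZeta) (f := fun s => s - (l : ℂ)) ?_ (by fun_prop)
  exact differentiableAt_riemannZeta fun h => h2 (by linear_combination h)

theorem differentiableAt_divisorPhi_of_lt_re {l : ℕ} {s : ℂ} (hs : (l : ℝ) + 1 < s.re) :
    DifferentiableAt ℂ (divisorPhi l) s := by
  have : (0 : ℝ) ≤ l := l.cast_nonneg
  refine differentiableAt_divisorPhi ?_ ?_
  · rintro rfl; simp at hs; linarith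
  · rintro rfl; simp at hs

theorem continuous_divisorPhi_comp {l : ℕ} {s : ℝ → ℂ} (hs : Continuous s)
    (h : ∀ y, (l : ℝ) + 1 < (s y).re) : Continuous fun y => divisorPhi l (s y) :=
  continuous_iff_continuousAt.2 fun y =>
    (differentiableAt_divisorPhi_of_lt_re (h y)).continuousAt.comp hs.continuousAt

/-! ### The series G as a Riesz mean -/

section kernel

variable {l k : ℕ} {γ : ℝ} {u v : ℂ}

/-- Integrability of the Gamma factors along the line `Re w = l + 1 - Re u - γ`. -/
theorem integrable_gammaKernel (hγ : (l : ℝ) + 1 < γ) (hγk : 2 * γ - (l + 1) < k)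
    {c : ℝ} (hcdef : c = l + 1 - u.re - γ) (hc : ∀ j : ℕ, j ≤ k → c + j ≠ 0) :
    Integrable fun y : ℝ => Gamma (l + 1 - u - (c + y * I)) *
      (Gamma (u + (c + y * I)))⁻¹ / risingProd k (c + y * I) := by
  have hl : (0 : ℝ) ≤ l := l.cast_nonneg
  obtain ⟨CQ, hQ⟩ := exists_norm_Gamma_div_Gamma_le l (γ := γ) (by linarith)
  obtain ⟨C, hC0, hC⟩ := exists_pow_le_norm_risingProd hc
  set κ := 2 * γ - (l + 1) with hκ
  have hκ0 : 0 ≤ κ := by linarith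
  have hre : ∀ y : ℝ, (l + 1 - u - (c + y * I) : ℂ).re = γ := by intro y; simp [hcdef]
  have hline : ∀ y : ℝ, (c + y * I : ℂ).re = c ∧ (c + y * I : ℂ).im = y := fun y => by simp
  have hne : ∀ y : ℝ, risingProd k (c + y * I) ≠ 0 := fun y => risingProd_ne_zero fun j hj h0 => by
    have := congrArg re h0
    simp at this
    exact hc j hj this
  -- The Gamma quotient grows like |y|^κ, and the rising product has k + 1 factors. Integrability is
  -- k + 1 - κ > 1, which is the condition 2γ - (l + 1) < k.
  have hint : Integrable fun y : ℝ => |CQ| * (1 + |u.im|) ^ κ * C * (1 + ‖y‖) ^ (-(k + 1 - κ)) :=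
    (integrable_one_add_norm (by simp; linarith)).const_mul _
  refine hint.mono' (Continuous.aestronglyMeasurable ?_) (.of_forall fun y => ?_)
  · refine Continuous.div (Continuous.mul ?_ ?_) ((continuous_risingProd k).comp (by fun_prop)) hne
    · refine continuous_iff_continuousAt.2 fun y => ?_
      refine ContinuousAt.comp (f := fun y : ℝ => (l + 1 - u - (c + y * I) : ℂ)) ?_ (by fun_prop)
      refine (differentiableAt_Gamma _ fun m h => ?_).continuousAt
      have h2 := hre y
      rw [h] at h2
      simp at h2
      have : (0 : ℝ) ≤ m := m.cast_nonneg
      linarith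
    · exact differentiable_one_div_Gamma.continuous.comp (by fun_prop)
  · have h1 := hQ _ (hre y)
    have h2 : (l + 1 - (l + 1 - u - (c + y * I)) : ℂ) = u + (c + y * I) := by ring
    rw [h2] at h1
    have h3 := hC _ (hline y).1
    rw [(hline y).2] at h3
    have him : 1 + |(l + 1 - u - (c + y * I) : ℂ).im| ≤ (1 + |u.im|) * (1 + |y|) := by
      have : (l + 1 - u - (c + y * I) : ℂ).im = -(u.im + y) := by simp; ring
      rw [this, abs_neg]
      nlinarith [abs_add_le u.im y, abs_nonneg u.im, abs_nonneg y,
        mul_nonneg (abs_nonneg u.im) (abs_nonneg y)]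
    have hy : 0 < 1 + |y| := by positivity
    have hP : 0 < ‖risingProd k (c + y * I)‖ := norm_pos_iff.2 (hne y)
    rw [norm_div, div_le_iff₀ hP, Real.norm_eq_abs, Real.rpow_neg hy.le, Real.rpow_sub hy]
    have e1 : (1 + |y|) ^ ((k : ℝ) + 1) = (1 + |y|) ^ (k + 1) := by
      rw [← Real.rpow_natCast]; push_cast; rfl
    rw [e1]
    calc _ ≤ CQ * (1 + |(l + 1 - u - (c + y * I) : ℂ).im|) ^ κ := h1
      _ ≤ |CQ| * ((1 + |u.im|) * (1 + |y|)) ^ κ := by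
          gcongr
          exact le_abs_self _
      _ = |CQ| * (1 + |u.im|) ^ κ * (1 + |y|) ^ κ := by
          rw [Real.mul_rpow (by positivity) hy.le]; ring
      _ = |CQ| * (1 + |u.im|) ^ κ * (((1 + |y|) ^ (k + 1) / (1 + |y|) ^ κ)⁻¹ *
            (1 + |y|) ^ (k + 1)) := by
          have := (Real.rpow_pos_of_pos hy κ).ne'
          field_simp
      _ ≤ |CQ| * (1 + |u.im|) ^ κ * (((1 + |y|) ^ (k + 1) / (1 + |y|) ^ κ)⁻¹ *
            (C * ‖risingProd k (c + y * I)‖)) := by gcongr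
      _ = _ := by ring

/-- With s = l + 1 - u - w, the factors Γ(d - s) and Γ(b - s) become Γ(w) and Γ(w + k + 1), whose
quotient is the reciprocal of the rising product. Excluding real w keeps Γ(w) away from its poles,
and on a vertical line this omits a single point. -/
theorem meijerIntegrand_eq {n : ℕ} (hn : 0 < n) {x : ℝ} (hx : 0 < x) {w : ℂ} (hw : w.im ≠ 0) :
    (x : ℂ) ^ (l + 1 - u + k : ℂ) * ((2 * π : ℂ) ^ (l + 1) *
      meijerIntegrand (l + 1 - u + k + 1) (l + 1) (l + 1 - u) (1 / (4 * π ^ 2 * n * x))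
        (l + 1 - u - w)) =
    (2 * π : ℂ) ^ (l + 1 - 2 * (l + 1 - u - w)) *
      (Gamma (l + 1 - u - w) * (Gamma (u + w))⁻¹ / risingProd k w) * (x : ℂ) ^ (w + k) *
        ((n : ℂ) ^ (l + 1 - u - w))⁻¹ := by
  set s := (l + 1 - u - w : ℂ) with hs
  have hpi : (2 * π : ℂ) ≠ 0 := by simp [Real.pi_ne_zero]
  have hx0 : (x : ℂ) ≠ 0 := ofReal_ne_zero.2 hx.ne'
  have hz : (1 / (4 * π ^ 2 * n * x) : ℂ) ^ s =
      (2 * π : ℂ) ^ (-2 * s) * ((n : ℂ) ^ s)⁻¹ * (x : ℂ) ^ (-s) := by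
    have e1 : (4 * π ^ 2 * n * x : ℂ) = ((2 * π : ℝ) : ℂ) * ((2 * π : ℝ) : ℂ) * (n : ℝ) * x := by
      push_cast; ring
    have hpos : 0 ≤ 2 * π := by positivity
    have harg : arg (((2 * π : ℝ) : ℂ) * ((2 * π : ℝ) : ℂ) * (n : ℝ) * x) ≠ π := by
      have e : ((2 * π : ℝ) : ℂ) * ((2 * π : ℝ) : ℂ) * (n : ℝ) * x =
        ((2 * π * (2 * π) * n * x : ℝ) : ℂ) := by push_cast; ring
      rw [e, arg_ofReal_of_nonneg (by positivity)]
      exact Real.pi_ne_zero.symm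
    have e2 : (2 * π : ℂ) = ((2 * π : ℝ) : ℂ) := by push_cast; ring
    rw [e1, one_div, inv_cpow _ _ harg]
    rw [← ofReal_mul, ← ofReal_mul, mul_cpow_ofReal_nonneg (by positivity) hx.le, ofReal_mul,
      mul_cpow_ofReal_nonneg (by positivity) (by positivity), ofReal_mul,
      mul_cpow_ofReal_nonneg hpos hpos, cpow_neg, ← e2]
    have e3 : (-2 * s : ℂ) = -s + -s := by ring
    rw [e3, cpow_add _ _ hpi, cpow_neg, ofReal_natCast]
    simp only [mul_inv]
  have hne : ∀ j : ℕ, w + j ≠ 0 := by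
    intro j h
    have := congrArg im h
    simp at this
    exact hw this
  have hG0 : Gamma w ≠ 0 := Gamma_ne_zero fun m h => hne m (by rw [h]; ring)
  have e1 : (l + 1 - u - s : ℂ) = w := by rw [hs]; ring
  have e2 : (l + 1 - u + k + 1 - s : ℂ) = w + k + 1 := by rw [hs]; ring
  have e3 : (l + 1 - s : ℂ) = u + w := by rw [hs]; ring
  have e4 : (w + k : ℂ) = (l + 1 - u + k) + -s := by rw [hs]; ring
  have e5 : (l + 1 - 2 * s : ℂ) = ((l + 1 : ℕ) : ℂ) + (-2 * s) := by push_cast; ring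
  have hR := risingProd_ne_zero (m := k) fun j _ => hne j
  rw [meijerIntegrand, hz, e1, e2, e3, Gamma_add_natCast_add_one fun j _ => hne j, e4,
    cpow_add (l + 1 - u + k) (-s) hx0, e5, cpow_add ((l + 1 : ℕ) : ℂ) _ hpi,
    cpow_natCast _ (l + 1)]
  by_cases hG : Gamma (u + w) = 0
  · simp [hG]
  · generalize (x : ℂ) ^ (l + 1 - u + k : ℂ) = X
    field_simp

/-- On Re s = γ the modulus of n^(-s) is constant, so absolute convergence of the Dirichlet series
of f_(l+1-u-v) at γ justifies interchanging sum and integral. The series sums to φ(v - w)φ(s), and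
the functional equation turns φ(s) with its Gamma quotient into εφ(u + w), because ε² = 1. -/
theorem divisorG_eq_rieszIntegral (hl : Odd l) (hγ : (l : ℝ) + 1 < γ)
    (hγk : 2 * γ - (l + 1) < k) (huv : 2 * (l : ℝ) + 2 < u.re + v.re)
    {c : ℝ} (hcdef : c = l + 1 - u.re - γ) (hc : ∀ j : ℕ, j ≤ k → c + j ≠ 0) :
    DivisorGConverges l k γ u v ∧
    Integrable (fun y : ℝ => divisorPair l u v (c + y * I) / risingProd k (c + y * I)) ∧
    ∀ x : ℝ, 0 < x → divisorG l k γ u v x = (-1) ^ ((l + 1) / 2) / (2 * π) *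
      rieszIntegral volume (fun y => divisorPair l u v (c + y * I)) (fun y => c + y * I) k x := by
  have hl0 : (0 : ℝ) ≤ l := l.cast_nonneg
  have hpi : (2 * π : ℂ) ≠ 0 := by simp [Real.pi_ne_zero]
  have hGam := integrable_gammaKernel (u := u) hγ hγk hcdef hc
  -- The two line parameters are related by y = -Im u - t; the reversal and the translation do not
  -- affect integrals over ℝ.
  have hline : ∀ t : ℝ, (γ + t * I : ℂ) = l + 1 - u - (c + (-u.im - t : ℝ) * I) := by
    intro t
    rw [hcdef]
    apply Complex.ext
    · simp
    · simp
  set s : ℝ → ℂ := fun y => l + 1 - u - (c + y * I) with hs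
  have hsre : ∀ y, (s y).re = γ := by intro y; simp [hs, hcdef]
  have hscont : Continuous s := by fun_prop
  set Gk : ℝ → ℂ := fun y => Gamma (s y) * (Gamma (u + (c + y * I)))⁻¹ / risingProd k (c + y * I)
    with hGk
  have h2pi : ∀ y, ‖(2 * π : ℂ) ^ (l + 1 - 2 * s y)‖ = (2 * π) ^ ((l : ℝ) + 1 - 2 * γ) := by
    intro y
    have : (2 * π : ℂ) = ((2 * π : ℝ) : ℂ) := by push_cast; ring
    rw [this, norm_cpow_eq_rpow_re_of_pos (by positivity)]
    simp [hsre]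
  have hG1 : Integrable fun y => (2 * π : ℂ) ^ (l + 1 - 2 * s y) * Gk y :=
    hGam.bdd_mul (Continuous.aestronglyMeasurable
      ((continuous_const.sub (continuous_const.mul hscont)).const_cpow (Or.inl hpi)))
      (.of_forall fun y => (h2pi y).le)
  -- the kernel at a point `x`
  set B : ℝ → ℝ → ℂ := fun x y => (2 * π : ℂ) ^ (l + 1 - 2 * s y) * Gk y *
    (x : ℂ) ^ ((c + y * I : ℂ) + k) with hB
  have hBint : ∀ x : ℝ, 0 < x → Integrable (B x) := by
    intro x hx
    refine hG1.mul_bdd (c := x ^ (c + k)) (Continuous.aestronglyMeasurable ?_) (.of_forall fun y => ?_)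
    · exact Continuous.const_cpow (by fun_prop) (Or.inl (ofReal_ne_zero.2 hx.ne'))
    · rw [norm_cpow_eq_rpow_re_of_pos hx]; simp
  have hae : ∀ᵐ y : ℝ, y ≠ 0 := by simp [ae_iff]
  set f := divisorConv l (l + 1 - u - v) with hf
  have hFint : ∀ x : ℝ, 0 < x → ∀ n : ℕ, 0 < n → Integrable fun y => B x y * ((n : ℂ) ^ s y)⁻¹ := by
    intro x hx n hn
    have hn0 : (n : ℂ) ≠ 0 := Nat.cast_ne_zero.2 hn.ne'
    refine (hBint x hx).mul_bdd (c := ((n : ℝ) ^ γ)⁻¹) (Continuous.aestronglyMeasurable ?_)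
      (.of_forall fun y => ?_)
    · refine (hscont.const_cpow (Or.inl hn0)).inv₀ fun y => ?_
      simp [cpow_eq_zero_iff, hn0]
    · rw [norm_inv, norm_natCast_cpow_of_pos hn, hsre]
  have hmeij : ∀ x : ℝ, 0 < x → ∀ n : ℕ, 0 < n →
      (fun y => (x : ℂ) ^ (l + 1 - u + k : ℂ) * ((2 * π : ℂ) ^ (l + 1) *
        meijerIntegrand (l + 1 - u + k + 1) (l + 1) (l + 1 - u) (1 / (4 * π ^ 2 * n * x)) (s y)))
      =ᵐ[volume] fun y => B x y * ((n : ℂ) ^ s y)⁻¹ := by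
    intro x hx n hn
    filter_upwards [hae] with y hy
    exact meijerIntegrand_eq hn hx (by simpa using hy)
  have hxne : ∀ x : ℝ, 0 < x → (x : ℂ) ^ (l + 1 - u + k : ℂ) * (2 * π : ℂ) ^ (l + 1) ≠ 0 := by
    intro x hx
    refine mul_ne_zero ?_ (pow_ne_zero _ hpi)
    simp [cpow_eq_zero_iff, (ne_of_gt hx : x ≠ 0)]
  have hterm : ∀ x : ℝ, 0 < x → ∀ n : ℕ, (2 * π : ℂ) ^ (l + 1) * divisorGTerm l k γ u v x n =
      1 / (2 * π) * ∫ y, B x y * LSeries.term f (s y) n := by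
    intro x hx n
    rcases Nat.eq_zero_or_pos n with rfl | hn
    · simp [divisorGTerm, divisorConv]
    have h1 : ∀ y, B x y * LSeries.term f (s y) n = f n * (B x y * ((n : ℂ) ^ s y)⁻¹) := by
      intro y
      rw [LSeries.term_of_ne_zero hn.ne']; ring
    simp only [h1]
    rw [integral_const_mul, ← integral_congr_ae (hmeij x hx n hn), divisorGTerm, meijerG]
    simp only [integral_const_mul, integral_mul_const, hline]
    rw [integral_sub_left_eq_self (fun y => meijerIntegrand (l + 1 - u + k + 1) (l + 1) (l + 1 - u)
      (1 / (4 * π ^ 2 * n * x)) (s y)) volume (-u.im)]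
    have e : (1 / (2 * π * I) * I : ℂ) = 1 / (2 * π) := by field_simp
    linear_combination ((2 * π : ℂ) ^ (l + 1) * f n * (x : ℂ) ^ (l + 1 - u + k : ℂ) *
      ∫ y, meijerIntegrand (l + 1 - u + k + 1) (l + 1) (l + 1 - u)
        (1 / (4 * π ^ 2 * n * x)) (s y)) * e
  have hsumγ : Summable fun n => ‖LSeries.term f (γ : ℂ) n‖ := by
    refine Summable.norm (LSeriesHasSum_divisorConv (s := γ) (by simpa using hγ) ?_).summable
    simp; linarith
  have hnormterm : ∀ y n, ‖LSeries.term f (s y) n‖ = ‖LSeries.term f (γ : ℂ) n‖ := by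
    intro y n
    rw [LSeries.norm_term_eq, LSeries.norm_term_eq, hsre, ofReal_re]
  have hswap : ∀ x : ℝ, 0 < x → HasSum (fun n => ∫ y, B x y * LSeries.term f (s y) n)
      (∫ y, ∑' n, B x y * LSeries.term f (s y) n) := by
    intro x hx
    refine hasSum_integral_of_summable_integral_norm (fun n => ?_) ?_
    · rcases Nat.eq_zero_or_pos n with rfl | hn
      · simp
      · refine ((hFint x hx n hn).const_mul (f n)).congr (.of_forall fun y => ?_)
        simp only
        rw [LSeries.term_of_ne_zero hn.ne']; ring
    · simp only [norm_mul, hnormterm, integral_mul_const]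
      exact hsumγ.mul_left _
  have hpair : ∀ y, (2 * π : ℂ) ^ (l + 1 - 2 * s y) * Gk y *
      (divisorPhi l (v - (c + y * I)) * divisorPhi l (s y)) =
      (-1) ^ ((l + 1) / 2) * (divisorPair l u v (c + y * I) / risingProd k (c + y * I)) := by
    intro y
    have hfe := divisorPhi_one_add_sub hl (s := s y) (by rw [hsre]; exact hγ)
    have e1 : (l + 1 - s y : ℂ) = u + (c + y * I) := by simp only [hs]; ring
    rw [e1] at hfe
    have hε : ((-1 : ℂ) ^ ((l + 1) / 2)) * (-1) ^ ((l + 1) / 2) = 1 := by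
      rw [← mul_pow]; simp
    rw [divisorPair, hfe, hGk]
    linear_combination (-(2 * π : ℂ) ^ (l + 1 - 2 * s y) * (Gamma (s y) *
      (Gamma (u + (c + y * I)))⁻¹ / risingProd k (c + y * I)) *
      (divisorPhi l (v - (c + y * I)) * divisorPhi l (s y))) * hε
  have htsum : ∀ y, HasSum (fun n => LSeries.term f (s y) n)
      (divisorPhi l (v - (c + y * I)) * divisorPhi l (s y)) := by
    intro y
    have e1 : v - (c + y * I) = s y - (l + 1 - u - v) := by simp only [hs]; ring
    rw [e1]
    refine LSeriesHasSum_divisorConv (by rw [hsre]; exact hγ) ?_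
    rw [sub_re, hsre]; simp; linarith
  have hε0 : (-1 : ℂ) ^ ((l + 1) / 2) ≠ 0 := pow_ne_zero _ (by norm_num)
  refine ⟨fun x hx => ⟨fun n hn => ?_, ?_⟩, ?_, fun x hx => ?_⟩
  · simp only [hline]
    refine Integrable.comp_sub_left (f := fun y => meijerIntegrand (l + 1 - u + k + 1) (l + 1)
      (l + 1 - u) (1 / (4 * π ^ 2 * n * x)) (s y)) ?_ (-u.im)
    have h1 := ((integrable_congr (hmeij x hx n hn)).2 (hFint x hx n hn)).const_mul
      ((x : ℂ) ^ (l + 1 - u + k : ℂ) * (2 * π : ℂ) ^ (l + 1))⁻¹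
    refine h1.congr (.of_forall fun y => ?_)
    simp only
    rw [← mul_assoc ((x : ℂ) ^ (l + 1 - u + k : ℂ)), inv_mul_cancel_left₀ (hxne x hx)]
  · have h1 := ((hswap x hx).summable.mul_left (1 / (2 * π : ℂ)))
    simp only [← hterm x hx] at h1
    exact (summable_mul_left_iff (pow_ne_zero _ hpi)).1 h1
  · obtain ⟨C₁, h₁⟩ := exists_norm_divisorPhi_le l hγ
    obtain ⟨C₂, h₂⟩ := exists_norm_divisorPhi_le l (σ := v.re - c) (by linarith)
    have h3 : Integrable fun y => (2 * π : ℂ) ^ (l + 1 - 2 * s y) * Gk y *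
      (divisorPhi l (v - (c + y * I)) * divisorPhi l (s y)) := by
      refine hG1.mul_bdd (c := C₂ * C₁) ?_ (.of_forall fun y => ?_)
      · refine Continuous.aestronglyMeasurable (Continuous.mul ?_ ?_)
        · exact continuous_divisorPhi_comp (by fun_prop) fun y => by simp; linarith
        · exact continuous_divisorPhi_comp hscont fun y => by rw [hsre]; exact hγ
      · rw [norm_mul]
        exact mul_le_mul (h₂ _ (by simp)) (h₁ _ (hsre y).ge) (norm_nonneg _)
          ((norm_nonneg _).trans (h₂ (v - (c + y * I)) (by simp)))
    simp only [hpair] at h3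
    refine (h3.const_mul ((-1 : ℂ) ^ ((l + 1) / 2))⁻¹).congr (.of_forall fun y => ?_)
    simp only
    rw [inv_mul_cancel_left₀ hε0]
  · rw [divisorG, ← tsum_mul_left]
    simp only [hterm x hx]
    rw [tsum_mul_left, (hswap x hx).tsum_eq, rieszIntegral]
    have h1 : ∀ y, ∑' n, B x y * LSeries.term f (s y) n = (-1) ^ ((l + 1) / 2) *
        (divisorPair l u v (c + y * I) / risingProd k (c + y * I) * (x : ℂ) ^ ((c + y * I : ℂ) + k)) := by
      intro y
      rw [((htsum y).mul_left _).tsum_eq]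
      simp only [hB]
      linear_combination (x : ℂ) ^ ((c + y * I : ℂ) + k) * hpair y
    simp only [h1, integral_const_mul]
    ring

end kernel

/-! ### Moving the line of integration -/

section shift

variable {l k : ℕ} {γ : ℝ} {u v : ℂ}

/-- The two inequalities put both u + w and v - w strictly inside the half-plane of absolute
convergence. -/
theorem exists_norm_divisorPair_le {c : ℝ} (hcu : (l : ℝ) + 1 - u.re < c)
    (hcv : c < v.re - (l + 1)) :
    (Continuous fun y : ℝ => divisorPair l u v (c + y * I)) ∧
      ∃ C, ∀ y : ℝ, ‖divisorPair l u v (c + y * I)‖ ≤ C := by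
  constructor
  · refine Continuous.mul ?_ ?_
    · exact continuous_divisorPhi_comp (by fun_prop) fun y => by simp; linarith
    · exact continuous_divisorPhi_comp (by fun_prop) fun y => by simp; linarith
  · obtain ⟨C₁, h₁⟩ := exists_norm_divisorPhi_le l (σ := u.re + c) (by linarith)
    obtain ⟨C₂, h₂⟩ := exists_norm_divisorPhi_le l (σ := v.re - c) (by linarith)
    refine ⟨C₁ * C₂, fun y => ?_⟩
    rw [divisorPair, norm_mul]
    have h3 := h₁ (u + (c + y * I)) (by simp)
    exact mul_le_mul h3 (h₂ _ (by simp)) (norm_nonneg _) ((norm_nonneg _).trans h3)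

theorem integrable_div_risingProd {h : ℝ → ℂ} {c C : ℝ} {m : ℕ} (hm : 1 ≤ m)
    (hc : ∀ j : ℕ, j ≤ m → c + j ≠ 0) (hh : Continuous h) (hC : ∀ y, ‖h y‖ ≤ C) :
    Integrable fun y : ℝ => h y / risingProd m (c + y * I) := by
  obtain ⟨K, hK0, hK⟩ := exists_pow_le_norm_risingProd hc
  have hne : ∀ y : ℝ, risingProd m (c + y * I) ≠ 0 := fun y => risingProd_ne_zero fun j hj h0 => by
    have := congrArg re h0
    simp at this
    exact hc j hj this
  have hint : Integrable fun y : ℝ => C * K * (1 + ‖y‖) ^ (-(2 : ℝ)) :=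
    (integrable_one_add_norm (by simp)).const_mul _
  refine hint.mono' (Continuous.aestronglyMeasurable ?_) (.of_forall fun y => ?_)
  · exact hh.div ((continuous_risingProd m).comp (by fun_prop)) hne
  · have h1 := hK (c + y * I) (by simp)
    have him : (c + y * I : ℂ).im = y := by simp
    rw [him] at h1
    have hy : 1 ≤ 1 + |y| := by linarith [abs_nonneg y]
    have h2 : (1 + |y|) ^ 2 ≤ K * ‖risingProd m (c + y * I)‖ :=
      (pow_le_pow_right₀ hy (by omega)).trans h1
    have hP : 0 < ‖risingProd m (c + y * I)‖ := norm_pos_iff.2 (hne y)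
    have hC0 : 0 ≤ C := (norm_nonneg _).trans (hC y)
    rw [norm_div, Real.norm_eq_abs, Real.rpow_neg (by linarith), div_le_iff₀ hP]
    rw [Real.rpow_two]
    calc ‖h y‖ ≤ C * (((1 + |y|) ^ 2)⁻¹ * (1 + |y|) ^ 2) := by
          rw [inv_mul_cancel₀ (by positivity), mul_one]; exact hC y
      _ ≤ C * (((1 + |y|) ^ 2)⁻¹ * (K * ‖risingProd m (c + y * I)‖)) := by gcongr
      _ = _ := by ring

theorem differentiableAt_divisorPair {w : ℂ} (h1 : u + w ≠ 1) (h2 : u + w ≠ l + 1)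
    (h3 : (l : ℝ) + 1 < (v - w).re) : DifferentiableAt ℂ (divisorPair l u v) w := by
  refine DifferentiableAt.mul ?_ ?_
  · exact DifferentiableAt.comp w (g := divisorPhi l) (differentiableAt_divisorPhi h1 h2)
      (by fun_prop)
  · exact DifferentiableAt.comp w (g := divisorPhi l) (differentiableAt_divisorPhi_of_lt_re h3)
      (by fun_prop)

theorem pow_abs_im_le_norm_risingProd (m : ℕ) (z : ℂ) : |z.im| ^ (m + 1) ≤ ‖risingProd m z‖ := by
  rw [risingProd, norm_prod]
  calc |z.im| ^ (m + 1) = ∏ j ∈ Finset.range (m + 1), |z.im| := by simp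
    _ ≤ _ := Finset.prod_le_prod (fun j _ => abs_nonneg _) fun j _ => by
      simpa using abs_im_le_norm (z + j)

theorem risingProd_ne_zero_of_im_ne_zero (m : ℕ) {z : ℂ} (h : z.im ≠ 0) : risingProd m z ≠ 0 :=
  risingProd_ne_zero fun j _ h0 => h (by simpa using congrArg im h0)

/-- In the strip φ(u + w) is O(|Im w|^k) and φ(v - w) is bounded. The k + 1 factors of the rising
product therefore leave O(1/|Im w|), enough to discard the horizontal sides. -/
theorem rieszIntegral_sub_rieszIntegral (hl : Odd l) (hγ : (l : ℝ) + 1 < γ)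
    (hγk : 2 * γ - (l + 1) ≤ k) {c₁ c : ℝ} (hc₁ : c₁ = l + 1 - u.re - γ)
    (hcu : (l : ℝ) + 1 - u.re < c) (hcv : c < v.re - (l + 1)) (hk : 1 ≤ k)
    (hc : ∀ j : ℕ, j ≤ k → c + j ≠ 0)
    (hint : Integrable fun y : ℝ => divisorPair l u v (c₁ + y * I) / risingProd k (c₁ + y * I))
    {x : ℝ} (hx : 0 < x) :
    rieszIntegral volume (fun y => divisorPair l u v (c₁ + y * I)) (fun y => c₁ + y * I) k x =
    rieszIntegral volume (fun y => divisorPair l u v (c + y * I)) (fun y => c + y * I) k x +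
      I * rectIntegral (fun w => divisorPair l u v w / risingProd k w * (x : ℂ) ^ (w + k)) c₁ c
        (-(2 * (1 + |u.im|))) (2 * (1 + |u.im|)) := by
  have hl0 : (0 : ℝ) ≤ l := l.cast_nonneg
  have hcc : c₁ ≤ c := by linarith
  -- Above this height |Im(u + w)| is at least |Im w|/2 and positive, so the poles of φ(u + w) lie
  -- below it, and 1 + |Im(u + w)| ≤ 2|Im w|.
  set T := 2 * (1 + |u.im|) with hT
  have hT0 : 0 < T := by positivity
  obtain ⟨C, hC⟩ := exists_norm_divisorEntire_le hl (b := u.re + c) hγ hγk (by linarith)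
  obtain ⟨C₂, hC₂⟩ := exists_norm_divisorPhi_le l (σ := v.re - c) (by linarith)
  obtain ⟨M, hM⟩ := exists_rpow_le_of_mem_Icc (q := x) hx (c₁ + k) (c + k)
  have him : ∀ z : ℂ, T ≤ |z.im| → |z.im| / 2 ≤ |(u + z).im| ∧ 1 + |(u + z).im| ≤ 2 * |z.im| := by
    intro z hz
    have h1 := abs_add_le u.im z.im
    have h2 := abs_sub_abs_le_abs_sub z.im (-u.im)
    rw [abs_neg, sub_neg_eq_add, add_comm z.im] at h2
    rw [add_im]
    constructor <;> linarith
  have hsne : ∀ z : ℂ, T ≤ |z.im| → z.im ≠ 0 ∧ u + z ≠ 1 ∧ u + z ≠ l + 1 := by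
    intro z hz
    have h1 := (him z hz).1
    refine ⟨fun h => ?_, fun h => ?_, fun h => ?_⟩
    · rw [h, abs_zero] at hz; linarith
    · rw [h] at h1; simp at h1; linarith
    · rw [h] at h1; simp at h1; linarith
  have hx0 : (x : ℂ) ≠ 0 := ofReal_ne_zero.2 hx.ne'
  have key := integral_vertical_sub_eq_rectIntegral (a := c₁) (b := c) (T₀ := T)
    -- The power of 2 collects 2^(k+2) from (2|Im w|)^(k+2) and 4 from dividing by (|Im w|/2)².
    (C := |C| * 2 ^ (k + 4) * |C₂| * |M|)
    (f := fun w => divisorPair l u v w / risingProd k w * (x : ℂ) ^ (w + k)) hcc hT0 ?_ ?_ ?_ ?_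
  · rw [rieszIntegral, rieszIntegral, ← key]
    linear_combination (∫ y : ℝ, divisorPair l u v (c₁ + y * I) / risingProd k (c₁ + y * I) *
      (x : ℂ) ^ (c₁ + y * I + k : ℂ)) * I_mul_I - (∫ y : ℝ, divisorPair l u v (c + y * I) /
        risingProd k (c + y * I) * (x : ℂ) ^ (c + y * I + k : ℂ)) * I_mul_I
  · rintro z ⟨hz1, hz2⟩
    obtain ⟨h0, h1, h2⟩ := hsne z hz2
    refine DifferentiableAt.differentiableWithinAt ?_
    refine DifferentiableAt.mul (DifferentiableAt.div ?_ (differentiable_risingProd k z)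
      (risingProd_ne_zero_of_im_ne_zero k h0)) ?_
    · exact differentiableAt_divisorPair h1 h2 (by simp; linarith [hz1.2])
    · exact DifferentiableAt.const_cpow (by fun_prop) (Or.inl hx0)
  · intro z hz1 hz2
    obtain ⟨h0, h1, h2⟩ := hsne z hz2
    obtain ⟨h3, h4⟩ := him z hz2
    have hY : 0 < |z.im| := hT0.trans_le hz2
    have e1 : ‖divisorPhi l (u + z)‖ ≤ |C| * 2 ^ (k + 4) * |z.im| ^ k := by
      have h5 := hC (u + z) (by simp; linarith [hz1.1]) (by simp; linarith [hz1.2])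
      rw [divisorEntire_eq h1 h2, norm_mul, norm_mul] at h5
      have h6 : |z.im| / 2 ≤ ‖u + z - 1‖ := h3.trans (by simpa using abs_im_le_norm (u + z - 1))
      have h7 : |z.im| / 2 ≤ ‖u + z - l - 1‖ :=
        h3.trans (by simpa using abs_im_le_norm (u + z - l - 1))
      have h8 : (|z.im| / 2) * (|z.im| / 2) * ‖divisorPhi l (u + z)‖ ≤
          |C| * (2 * |z.im|) ^ (k + 2) := by
        calc _ ≤ ‖u + z - 1‖ * ‖u + z - l - 1‖ * ‖divisorPhi l (u + z)‖ := by gcongr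
          _ ≤ C * (1 + |(u + z).im|) ^ (k + 2) := h5
          _ ≤ _ := by
            gcongr
            exact le_abs_self _
      have h9 : (0 : ℝ) < |z.im| / 2 * (|z.im| / 2) := by positivity
      rw [← mul_le_mul_iff_right₀ h9]
      refine h8.trans (le_of_eq ?_)
      ring
    have e2 : ‖divisorPhi l (v - z)‖ ≤ |C₂| :=
      (hC₂ _ (by simp; linarith [hz1.2])).trans (le_abs_self _)
    have e3 : ‖(x : ℂ) ^ (z + k)‖ ≤ |M| := by
      rw [norm_cpow_eq_rpow_re_of_pos hx]
      refine (hM x ⟨le_rfl, le_rfl⟩ _ ?_).trans (le_abs_self _)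
      simpa using hz1
    have e4 := pow_abs_im_le_norm_risingProd k z
    rw [divisorPair, norm_mul, norm_div, norm_mul, le_div_iff₀ hY]
    calc _ ≤ (|C| * 2 ^ (k + 4) * |z.im| ^ k * |C₂|) / |z.im| ^ (k + 1) * |M| * |z.im| := by gcongr
      _ = _ := by field_simp; ring
  · exact integrable_rieszIntegrand (A := c₁) (B := c₁) (by fun_prop) (.of_forall fun y => by simp)
      hint hx
  · obtain ⟨hcont, C', hC'⟩ := exists_norm_divisorPair_le hcu hcv
    exact integrable_rieszIntegrand (A := c) (B := c) (by fun_prop) (.of_forall fun y => by simp)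
      (integrable_div_risingProd hk hc hcont hC') hx

/-- On a compact segment integrability is automatic at every order, so the descent goes all the way
to order 0, where the rising product is just w. -/
theorem contDiffOn_integral_segment {h : ℂ → ℂ} {w : ℝ → ℂ} {p q : ℝ} (hpq : p ≤ q)
    (hw : Continuous w) (hh : ContinuousOn h (w '' Icc p q))
    (hne : ∀ s ∈ Icc p q, ∀ j : ℕ, j ≤ k → w s + j ≠ 0) :
    ContDiffOn ℝ k (fun x : ℝ => ∫ s in p..q, h (w s) / risingProd k (w s) *
      (x : ℂ) ^ (w s + k)) (Ioi 0) ∧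
    ∀ x > 0, iteratedDeriv k (fun x : ℝ => ∫ s in p..q, h (w s) / risingProd k (w s) *
      (x : ℂ) ^ (w s + k)) x = ∫ s in p..q, h (w s) / w s * (x : ℂ) ^ (w s) := by
  set μ := volume.restrict (Ioc p q)
  have hmem : ∀ᵐ s ∂μ, s ∈ Icc p q :=
    (ae_restrict_mem measurableSet_Ioc).mono fun s hs => Ioc_subset_Icc_self hs
  have hre : ContinuousOn (fun s => (w s).re) (Icc p q) := (continuous_re.comp hw).continuousOn
  obtain ⟨R, hR⟩ := isCompact_Icc.exists_bound_of_continuousOn hre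
  have hAB : ∀ᵐ s ∂μ, (w s).re ∈ Icc (-R) R := hmem.mono fun s hs => abs_le.1 (hR s hs)
  have hI : ∀ i, 0 ≤ i → i ≤ 0 + k → Integrable (fun s => h (w s) / risingProd i (w s)) μ := by
    intro i _ hi
    have hc : ContinuousOn (fun s => h (w s) / risingProd i (w s)) (Icc p q) := by
      refine ContinuousOn.div (hh.comp hw.continuousOn (mapsTo_image _ _))
        ((continuous_risingProd i).comp hw).continuousOn fun s hs => ?_
      exact risingProd_ne_zero fun j hj => hne s hs j (by omega)
    exact (hc.integrableOn_Icc).mono_set Ioc_subset_Icc_self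
  have key := contDiffOn_rieszIntegral (μ := μ) (H := fun s => h (w s)) hw hAB 0 k
    (hmem.mono fun s hs j hj => hne s hs j (by omega)) hI
  rw [zero_add] at key
  have e : rieszIntegral μ (fun s => h (w s)) w k = fun x : ℝ => ∫ s in p..q,
      h (w s) / risingProd k (w s) * (x : ℂ) ^ (w s + k) := by
    ext x
    rw [intervalIntegral.integral_of_le hpq, rieszIntegral]
  rw [e] at key
  refine ⟨key.1, fun x hx => ?_⟩
  rw [key.2 x hx, rieszIntegral, intervalIntegral.integral_of_le hpq]
  simp [risingProd, μ]

theorem iteratedDeriv_sub_add_sub {f₁ f₂ f₃ f₄ : ℝ → ℂ} {x : ℝ} (h₁ : ContDiffAt ℝ k f₁ x)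
    (h₂ : ContDiffAt ℝ k f₂ x) (h₃ : ContDiffAt ℝ k f₃ x) (h₄ : ContDiffAt ℝ k f₄ x) :
    iteratedDeriv k (fun x => f₁ x - f₂ x + I * f₃ x - I * f₄ x) x =
      iteratedDeriv k f₁ x - iteratedDeriv k f₂ x + I * iteratedDeriv k f₃ x -
        I * iteratedDeriv k f₄ x := by
  have h₃' : ContDiffAt ℝ k (I • f₃) x := h₃.const_smul I
  have h₄' : ContDiffAt ℝ k (I • f₄) x := h₄.const_smul I
  have h₁₂ : ContDiffAt ℝ k (f₁ - f₂) x := h₁.sub h₂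
  have h₁₂₃ : ContDiffAt ℝ k (f₁ - f₂ + I • f₃) x := h₁₂.add h₃'
  have e : (fun x => f₁ x - f₂ x + I * f₃ x - I * f₄ x) = ((f₁ - f₂) + I • f₃) - I • f₄ := rfl
  rw [e, iteratedDeriv_sub h₁₂₃ h₄', iteratedDeriv_add h₁₂ h₃',
    iteratedDeriv_sub h₁ h₂, iteratedDeriv_const_smul h₃ I, iteratedDeriv_const_smul h₄ I]
  rfl

theorem contDiffOn_rectIntegral {h : ℂ → ℂ} {a b c d : ℝ} (hab : a ≤ b) (hcd : c ≤ d)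
    (hh : ContinuousOn h (rectFrame a b c d))
    (hne : ∀ z ∈ rectFrame a b c d, ∀ j : ℕ, j ≤ k → z + j ≠ 0) :
    ContDiffOn ℝ k (fun x : ℝ => rectIntegral (fun z => h z / risingProd k z * (x : ℂ) ^ (z + k))
      a b c d) (Ioi 0) ∧
    ∀ x > 0, iteratedDeriv k (fun x : ℝ => rectIntegral (fun z => h z / risingProd k z *
      (x : ℂ) ^ (z + k)) a b c d) x = rectIntegral (fun z => h z / z * (x : ℂ) ^ z) a b c d := by
  have hb : MapsTo (fun x : ℝ => (x + c * I : ℂ)) (Icc a b) (rectFrame a b c d) := fun x hx =>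
    mem_rectFrame_bottom hcd (by rwa [uIcc_of_le hab]) hab
  have ht : MapsTo (fun x : ℝ => (x + d * I : ℂ)) (Icc a b) (rectFrame a b c d) := fun x hx =>
    mem_rectFrame_top hcd (by rwa [uIcc_of_le hab]) hab
  have hr : MapsTo (fun y : ℝ => (b + y * I : ℂ)) (Icc c d) (rectFrame a b c d) := fun x hx =>
    mem_rectFrame_right hcd (by rwa [uIcc_of_le hcd]) hab
  have hl : MapsTo (fun y : ℝ => (a + y * I : ℂ)) (Icc c d) (rectFrame a b c d) := fun x hx =>
    mem_rectFrame_left hcd (by rwa [uIcc_of_le hcd]) hab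
  obtain ⟨c1, d1⟩ := contDiffOn_integral_segment hab (by fun_prop) (hh.mono hb.image_subset)
    fun s hs => hne _ (hb hs)
  obtain ⟨c2, d2⟩ := contDiffOn_integral_segment hab (by fun_prop) (hh.mono ht.image_subset)
    fun s hs => hne _ (ht hs)
  obtain ⟨c3, d3⟩ := contDiffOn_integral_segment hcd (by fun_prop) (hh.mono hr.image_subset)
    fun s hs => hne _ (hr hs)
  obtain ⟨c4, d4⟩ := contDiffOn_integral_segment hcd (by fun_prop) (hh.mono hl.image_subset)
    fun s hs => hne _ (hl hs)
  unfold rectIntegral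
  have c3' := c3.const_smul I
  have c4' := c4.const_smul I
  refine ⟨(((c1.sub c2).add c3').sub c4'), fun x hx => ?_⟩
  have hn := isOpen_Ioi.mem_nhds (show x ∈ Ioi (0 : ℝ) from hx)
  have a1 := c1.contDiffAt hn
  have a2 := c2.contDiffAt hn
  have a3 := c3.contDiffAt hn
  have a4 := c4.contDiffAt hn
  have key := iteratedDeriv_sub_add_sub a1 a2 a3 a4
  rw [d1 x hx, d2 x hx, d3 x hx, d4 x hx] at key
  exact key

/-- Multiplying by the two factors that vanish at the poles of φ(u + w) leaves a holomorphic g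
divided by a cubic with the distinct zeros 0, 1 - u and l + 1 - u. Partial fractions reduce
everything to Cauchy's formula. The last two zeros always lie inside the rectangle, while 0 does
only when c > 0. -/
theorem rectIntegral_divisorPair_div {c₁ c T : ℝ} (hl : l ≠ 0) (hu1 : u ≠ 1) (hul : u ≠ l + 1)
    (hc₁ : c₁ < -u.re) (hc₁0 : c₁ < 0) (hc0 : c ≠ 0) (hcu : (l : ℝ) + 1 - u.re < c)
    (hcv : c < v.re - (l + 1)) (hT : |u.im| < T) :
    rectIntegral (fun w => divisorPair l u v w / w) c₁ c (-T) T = 2 * π * I *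
      ((if 0 < c then divisorPhi l u * divisorPhi l v else 0) +
        riemannZeta (1 - l) / (1 - u) * divisorPhi l (u + v - 1) +
        riemannZeta (1 + l) / (l + 1 - u) * divisorPhi l (u + v - l - 1)) := by
  have hl0 : (0 : ℝ) ≤ l := l.cast_nonneg
  have hT0 : 0 < T := (abs_nonneg _).trans_lt hT
  obtain ⟨hT1, hT2⟩ := abs_lt.1 hT
  have hab : c₁ ≤ c := by linarith
  have hcd : -T ≤ T := by linarith
  set g : ℂ → ℂ := fun w => divisorEntire l (u + w) * divisorPhi l (v - w) with hg
  have hgd : DifferentiableOn ℂ g (Icc c₁ c ×ℂ Icc (-T) T) := by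
    rintro w ⟨hw1, -⟩
    refine DifferentiableAt.differentiableWithinAt (DifferentiableAt.mul ?_ ?_)
    · exact DifferentiableAt.comp w (g := divisorEntire l) (differentiable_divisorEntire l _)
        (by fun_prop)
    · refine DifferentiableAt.comp w (g := divisorPhi l)
        (differentiableAt_divisorPhi_of_lt_re ?_) (by fun_prop)
      have := hw1.2
      simp
      linarith
  have hgc := hgd.continuousOn.mono rectFrame_subset
  have hp2 : (1 - u : ℂ) ≠ 0 := sub_ne_zero.2 hu1.symm
  have hp3 : (l + 1 - u : ℂ) ≠ 0 := sub_ne_zero.2 hul.symm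
  have hlc : (l : ℂ) ≠ 0 := Nat.cast_ne_zero.2 hl
  have hframe : ∀ p : ℂ, p.re ≠ c₁ → p.re ≠ c → p.im ≠ -T → p.im ≠ T →
      ∀ z ∈ rectFrame c₁ c (-T) T, z - p ≠ 0 := by
    rintro p h1 h2 h3 h4 z ⟨-, -, hz⟩ h0
    rw [sub_eq_zero] at h0
    subst h0
    rcases hz with h | h | h | h
    · exact h1 h
    · exact h2 h
    · exact h3 h
    · exact h4 h
  have f1 := hframe 0 (by simpa using hc₁0.ne') (by simpa using hc0.symm) (by simp; linarith)
    (by simpa using hT0.ne)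
  have f2 := hframe (1 - u) (by simp; linarith) (by simp; linarith) (by simp; linarith)
    (by simp; linarith)
  have f3 := hframe (l + 1 - u) (by simp; linarith) (by simp; linarith) (by simp; linarith)
    (by simp; linarith)
  have e : EqOn (fun w => divisorPair l u v w / w)
      (fun w => ((1 - u) * (l + 1 - u))⁻¹ * (g w / (w - 0)) +
        (((1 - u) * (-l))⁻¹ * (g w / (w - (1 - u))) +
        ((l + 1 - u) * l)⁻¹ * (g w / (w - (l + 1 - u))))) (rectFrame c₁ c (-T) T) := by
    intro w hw
    have g1 := f1 w hw
    have g2 := f2 w hw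
    have g3 := f3 w hw
    rw [sub_zero] at g1
    have h1 : u + w ≠ 1 := fun h => g2 (by linear_combination h)
    have h2 : u + w ≠ l + 1 := fun h => g3 (by linear_combination h)
    simp only [hg, divisorPair, divisorEntire_eq h1 h2, sub_zero]
    have i2 : (u + w - 1) = w - (1 - u) := by ring
    have i3 : (u + w - l - 1) = w - (l + 1 - u) := by ring
    rw [i2, i3]
    generalize hA : w - (1 - u) = A at *
    generalize hB : w - (l + 1 - u) = B at *
    field_simp
    rw [← hA, ← hB]
    ring
  have hcdiv : ∀ p : ℂ, (∀ z ∈ rectFrame c₁ c (-T) T, z - p ≠ 0) → ∀ r : ℂ,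
      ContinuousOn (fun w => r * (g w / (w - p))) (rectFrame c₁ c (-T) T) := fun p hp r =>
    continuousOn_const.mul (hgc.div (by fun_prop) hp)
  have hadd : ContinuousOn (fun w => ((1 - u) * (-l))⁻¹ * (g w / (w - (1 - u))) +
      ((l + 1 - u) * l)⁻¹ * (g w / (w - (l + 1 - u)))) (rectFrame c₁ c (-T) T) :=
    (hcdiv _ f2 _).add (hcdiv _ f3 _)
  rw [rectIntegral_congr hab hcd e, rectIntegral_add hab hcd (hcdiv _ f1 _) hadd, rectIntegral_add hab hcd (hcdiv _ f2 _) (hcdiv _ f3 _),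
    rectIntegral_const_mul, rectIntegral_const_mul, rectIntegral_const_mul]
  rw [rectIntegral_div_sub (p := 1 - u) (by simp; linarith) (by simp; linarith)
    (by simp; linarith) (by simp; linarith) hgd,
    rectIntegral_div_sub (p := l + 1 - u) (by simp; linarith) (by simp; linarith)
    (by simp; linarith) (by simp; linarith) hgd]
  have v2 : g (1 - u) = -l * riemannZeta (1 - l) * divisorPhi l (u + v - 1) := by
    simp only [hg]
    rw [← divisorEntire_one hl]
    congr 2 <;> ring
  have v3 : g (l + 1 - u) = l * riemannZeta (1 + l) * divisorPhi l (u + v - l - 1) := by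
    simp only [hg]
    rw [← divisorEntire_add_one hl]
    congr 2 <;> ring
  have v1 : g 0 = (1 - u) * (l + 1 - u) * (divisorPhi l u * divisorPhi l v) := by
    simp only [hg, add_zero, sub_zero, divisorEntire_eq hu1 hul]
    ring
  have w1 : rectIntegral (fun w => g w / (w - 0)) c₁ c (-T) T = 2 * π * I *
      (if 0 < c then g 0 else 0) := by
    split_ifs with h
    · exact rectIntegral_div_sub (by simpa using hc₁0) (by simpa using h) (by simpa using hT0)
        (by simpa using hT0) hgd
    · rw [mul_zero]
      refine rectIntegral_eq_zero hab hcd (hgd.div (by fun_prop) fun z hz h0 => ?_)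
      rw [sub_zero] at h0
      subst h0
      have := hz.1.2
      simp only [zero_re] at this
      exact h (lt_of_le_of_ne this hc0.symm)
  rw [w1, v1, v2, v3]
  split_ifs
  · field_simp
    ring
  · field_simp
    ring

end shift

/-! ### The mean k-th derivative of one of the two functions G -/

section oneSide

variable {l k : ℕ} {γ : ℝ} {u v : ℂ}

/-- On the infinite line differentiation under the integral stops at order 1, where the kernel still
decays quadratically; the last, one-sided derivative is an input. The rectangle is smooth enough for
all k derivatives, and at x = 1 its k-th derivative is the residue sum. The prefactor ε/(2π) · I ·
2πI = -ε gives that sum its sign. -/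
theorem HasMeanIteratedDerivAt.of_riesz (hl : Odd l) (hk : l + 1 < k) (hγ : (l : ℝ) + 1 < γ)
    (hγk : 2 * γ - (l + 1) < k) (huv : 2 * (l : ℝ) + 2 < u.re + v.re)
    (hu : (l : ℝ) + 1 - γ < u.re) (hu1 : u ≠ 1) (hul : u ≠ l + 1)
    (hγu : ∀ j : ℕ, j ≤ k → (l : ℝ) + 1 - u.re + j ≠ γ)
    {c : ℝ} (hcu : (l : ℝ) + 1 - u.re < c) (hcv : c < v.re - (l + 1))
    (hc : ∀ j : ℕ, j ≤ k → c + j ≠ 0) {D₁ D₂ : ℂ}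
    (h₁ : HasDerivWithinAt (rieszIntegral volume (fun y => divisorPair l u v (c + y * I))
      (fun y => c + y * I) 1) D₁ (Iic 1) 1)
    (h₂ : HasDerivWithinAt (rieszIntegral volume (fun y => divisorPair l u v (c + y * I))
      (fun y => c + y * I) 1) D₂ (Ici 1) 1) :
    DivisorGConverges l k γ u v ∧
    HasMeanIteratedDerivAt k (divisorG l k γ u v)
      ((-1) ^ ((l + 1) / 2) * ((D₁ + D₂) / (4 * π) -
        ((if 0 < c then divisorPhi l u * divisorPhi l v else 0) +
          riemannZeta (1 - l) / (1 - u) * divisorPhi l (u + v - 1) +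
          riemannZeta (1 + l) / (l + 1 - u) * divisorPhi l (u + v - l - 1)))) 1 := by
  have hl0 : (0 : ℝ) ≤ l := l.cast_nonneg
  have hlne : l ≠ 0 := by rintro rfl; simp at hl
  -- K = k - 1 derivatives take the order from 1 + K to 1.
  obtain ⟨K, rfl⟩ : ∃ K, k = 1 + K := ⟨k - 1, by omega⟩
  set c₁ : ℝ := l + 1 - u.re - γ with hc₁
  have hc₁ne : ∀ j : ℕ, j ≤ 1 + K → c₁ + j ≠ 0 := fun j hj h => hγu j hj (by linarith)
  obtain ⟨hconv, hint, hG⟩ := divisorG_eq_rieszIntegral hl hγ hγk huv hc₁ hc₁ne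
  refine ⟨hconv, ?_⟩
  set T := 2 * (1 + |u.im|) with hT
  have hT0 : 0 < T := by positivity
  set H : ℝ → ℂ := fun y => divisorPair l u v (c + y * I)
  set w : ℝ → ℂ := fun y => c + y * I
  have hw : Continuous w := by fun_prop
  obtain ⟨hcont, C, hC⟩ := exists_norm_divisorPair_le hcu hcv
  obtain ⟨a1, a2⟩ := contDiffOn_rieszIntegral (μ := volume) (H := H) (w := w) (A := c) (B := c) hw
    (.of_forall fun y => by simp [w]) 1 K
    (.of_forall fun y j hj h0 => hc j hj (by simpa [w] using congrArg re h0))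
    fun i hi hi' => integrable_div_risingProd hi (fun j hj => hc j (by omega)) hcont hC
  have hcc : c₁ ≤ c := by linarith
  have hneg : -T ≤ T := by linarith
  have hframe : ∀ z ∈ rectFrame c₁ c (-T) T, ∀ j : ℕ, j ≤ 1 + K → z + j ≠ 0 := by
    rintro z ⟨-, -, hz⟩ j hj h0
    have e1 := congrArg re h0
    have e2 := congrArg im h0
    simp at e1 e2
    rcases hz with h | h | h | h
    · exact hc₁ne j hj (by rw [← h, e1])
    · exact hc j hj (by rw [← h, e1])
    · linarith
    · linarith
  have hHframe : ContinuousOn (divisorPair l u v) (rectFrame c₁ c (-T) T) := by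
    rintro z ⟨hz1, -, hz⟩
    have hre : (l : ℝ) + 1 < (v - z).re := by
      have := hz1.2
      simp; linarith
    have hnot : ∀ r : ℝ, 0 < r → r ≤ l + 1 → u + z ≠ r := by
      intro r hr0 hr h0
      have e1 := congrArg re h0
      have e2 := congrArg im h0
      simp at e1 e2
      have := abs_le.1 (le_refl |u.im|)
      rcases hz with h | h | h | h <;> linarith
    refine (differentiableAt_divisorPair ?_ ?_ hre).continuousAt.continuousWithinAt
    · simpa using hnot 1 one_pos (by linarith)
    · simpa using hnot (l + 1) (by linarith) le_rfl
  obtain ⟨b1, b2⟩ := contDiffOn_rectIntegral hcc hneg hHframe hframe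
  set R : ℝ → ℂ := fun x => rectIntegral (fun z => divisorPair l u v z / risingProd (1 + K) z *
    (x : ℂ) ^ (z + (1 + K : ℕ))) c₁ c (-T) T with hR
  set A := rieszIntegral volume H w (1 + K)
  set ε : ℂ := (-1) ^ ((l + 1) / 2)
  have hGeq : EqOn (divisorG l (1 + K) γ u v) (fun x => ε / (2 * π) * (A x + I * R x)) (Ioi 0) := by
    intro x hx
    rw [hG x hx, rieszIntegral_sub_rieszIntegral hl hγ hγk.le hc₁ hcu hcv (by omega) hc hint hx]
  have hmem : Ioi (0 : ℝ) ∈ 𝓝 1 := isOpen_Ioi.mem_nhds (by simp)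
  have hAat : ∀ x ∈ Ioi (0 : ℝ), ContDiffAt ℝ K A x := fun x hx =>
    a1.contDiffAt (isOpen_Ioi.mem_nhds hx)
  have hRat : ∀ x ∈ Ioi (0 : ℝ), ContDiffAt ℝ K R x := fun x hx =>
    (b1.contDiffAt (isOpen_Ioi.mem_nhds hx)).of_le (by norm_cast; omega)
  have hit : EqOn (iteratedDeriv K (divisorG l (1 + K) γ u v)) (fun x => ε / (2 * π) *
      (rieszIntegral volume H w 1 x + I * iteratedDeriv K R x)) (Ioi 0) := by
    intro x hx
    rw [(hGeq.eventuallyEq_of_mem (isOpen_Ioi.mem_nhds hx)).iteratedDeriv_eq K]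
    have hIR : ContDiffAt ℝ K (I • R) x := (hRat x hx).const_smul I
    have hAIR : ContDiffAt ℝ K (A + I • R) x := (hAat x hx).add hIR
    have e : (fun x => ε / (2 * π) * (A x + I * R x)) = (ε / (2 * π)) • (A + I • R) := rfl
    rw [e, iteratedDeriv_const_smul hAIR, iteratedDeriv_add (hAat x hx) hIR,
      iteratedDeriv_const_smul (hRat x hx), a2 x hx]
    rfl
  have hRder : HasDerivAt (iteratedDeriv K R) (2 * π * I *
      ((if 0 < c then divisorPhi l u * divisorPhi l v else 0) +
        riemannZeta (1 - l) / (1 - u) * divisorPhi l (u + v - 1) +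
        riemannZeta (1 + l) / (l + 1 - u) * divisorPhi l (u + v - l - 1))) 1 := by
    have hd : DifferentiableAt ℝ (iteratedDeriv K R) 1 := by
      have h4 := (b1.contDiffAt hmem).contDiffWithinAt (s := univ)
      have h5 := h4.differentiableWithinAt_iteratedDerivWithin (m := K) (by norm_cast; omega)
        (by simp [uniqueDiffOn_univ])
      rwa [iteratedDerivWithin_univ, differentiableWithinAt_univ] at h5
    have h3 := b2 1 one_pos
    rw [Nat.add_comm 1 K, iteratedDeriv_succ] at h3
    simp only [ofReal_one, one_cpow, mul_one] at h3
    rw [rectIntegral_divisorPair_div hlne hu1 hul (by linarith) (by linarith)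
      (by simpa using hc 0 (by omega)) hcu hcv (by linarith [abs_nonneg u.im])] at h3
    rw [← h3]
    exact hd.hasDerivAt
  have hone : (1 : ℝ) ∈ Ioi (0 : ℝ) := by simp
  have hside : ∀ (S : Set ℝ) (D : ℂ), (1 : ℝ) ∈ S →
      HasDerivWithinAt (rieszIntegral volume H w 1) D S 1 →
      HasDerivWithinAt (iteratedDeriv K (divisorG l (1 + K) γ u v)) (ε / (2 * π) * (D + I *
        (2 * π * I * ((if 0 < c then divisorPhi l u * divisorPhi l v else 0) +
        riemannZeta (1 - l) / (1 - u) * divisorPhi l (u + v - 1) +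
        riemannZeta (1 + l) / (l + 1 - u) * divisorPhi l (u + v - l - 1))))) S 1 := by
    intro S D hS hD
    refine ((hD.add (hRder.hasDerivWithinAt.const_mul I)).const_mul (ε / (2 * π))).congr_of_eventuallyEq
      ?_ (hit hone)
    exact Filter.mem_of_superset (mem_nhdsWithin_of_mem_nhds hmem) hit
  refine ⟨?_, _, _, by simpa using hside (Iic 1) D₁ (by simp) h₁,
    by simpa using hside (Ici 1) D₂ (by simp) h₂, ?_⟩
  · have h4 : ContDiffAt ℝ K (fun x => ε / (2 * π) * (A x + I * R x)) 1 :=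
      contDiffAt_const.mul ((hAat 1 hone).add (contDiffAt_const.mul (hRat 1 hone)))
    simpa using h4.congr_of_eventuallyEq (hGeq.eventuallyEq_of_mem hmem)
  · have hpi : (π : ℂ) ≠ 0 := ofReal_ne_zero.2 Real.pi_ne_zero
    generalize ((if 0 < c then divisorPhi l u * divisorPhi l v else 0) +
        riemannZeta (1 - l) / (1 - u) * divisorPhi l (u + v - 1) +
        riemannZeta (1 + l) / (l + 1 - u) * divisorPhi l (u + v - l - 1)) = X
    have e : I * (2 * π * I * X) = -(2 * π * X) := by linear_combination (2 * π * X) * I_mul_I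
    rw [e]
    field_simp
    ring

end oneSide

/-! ### One-sided derivatives on the line of absolute convergence -/

theorem mellin_max_one_sub {s : ℂ} (hs : 0 < s.re) :
    HasMellin (fun t : ℝ => ((max (1 - t) 0 : ℝ) : ℂ)) s (1 / (s * (s + 1))) := by
  have h1 := hasMellin_one_Ioc hs
  have h2 := hasMellin_cpow_Ioc 1 (s := s) (by simp; linarith)
  have h3 := hasMellin_sub h1.1 h2.1
  have e : EqOn (fun t : ℝ => (Ioc (0 : ℝ) 1).indicator (fun _ => (1 : ℂ)) t -
      (Ioc (0 : ℝ) 1).indicator (fun t : ℝ => (t : ℂ) ^ (1 : ℂ)) t)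
      (fun t : ℝ => ((max (1 - t) 0 : ℝ) : ℂ)) (Ioi 0) := by
    intro t (ht : 0 < t)
    by_cases h : t ≤ 1
    · simp [ht, h]
    · push Not at h
      simp [h.not_ge, max_eq_right (by linarith : 1 - t ≤ 0)]
  have h0 : s ≠ 0 := by rintro rfl; simp at hs
  have h10 : s + 1 ≠ 0 := by
    intro h
    have := congrArg re h
    simp at this
    linarith
  rw [h1.2, h2.2] at h3
  have e2 : (1 / s - 1 / (s + 1) : ℂ) = 1 / (s * (s + 1)) := by field_simp; ring
  rw [e2] at h3
  refine ⟨h3.1.congr_fun (fun t ht => ?_) measurableSet_Ioi, ?_⟩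
  · simp only [← e ht]
  · rw [← h3.2]
    exact setIntegral_congr_fun measurableSet_Ioi fun t ht => by simp only [← e ht]

/-- Perron's formula of order 1: the ramp max(1 - t, 0) is continuous and its Mellin transform
1/(s(s + 1)) is integrable on vertical lines, so Mellin inversion applies at every t > 0. -/
theorem integral_cpow_neg_div_risingProd_one {c t : ℝ} (hc : 0 < c) (ht : 0 < t) :
    ∫ y : ℝ, (t : ℂ) ^ (-(c + y * I : ℂ)) / risingProd 1 (c + y * I) =
      2 * π * ((max (1 - t) 0 : ℝ) : ℂ) := by
  have hm : ∀ y : ℝ, mellin (fun t : ℝ => ((max (1 - t) 0 : ℝ) : ℂ)) (c + y * I) =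
      1 / risingProd 1 (c + y * I) := by
    intro y
    rw [(mellin_max_one_sub (by simpa using hc)).2]
    simp [risingProd, Finset.prod_range_succ]
  have h1 := mellinInv_mellin_eq c (fun t : ℝ => ((max (1 - t) 0 : ℝ) : ℂ)) ht
    (mellin_max_one_sub (by simpa using hc)).1 ?_ (by fun_prop)
  · simp only [mellinInv, hm, smul_eq_mul] at h1
    rw [← h1]
    simp only [mul_one_div, real_smul]
    have hpi : (π : ℂ) ≠ 0 := ofReal_ne_zero.2 Real.pi_ne_zero
    push_cast
    rw [← mul_assoc, mul_one_div_cancel (mul_ne_zero two_ne_zero hpi), one_mul]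
  · unfold VerticalIntegrable
    simp only [hm]
    exact integrable_div_risingProd (h := fun _ => 1) (C := 1) le_rfl
      (fun j _ => by positivity) continuous_const (by simp)

/-- Dominated convergence for the difference quotients. Summable Lipschitz constants at x₀ replace
derivative bounds near x₀, which are unavailable for terms with kinks. -/
theorem hasDerivWithinAt_tsum_of_lipschitz {ι : Type*} {g : ι → ℝ → ℂ} {g' : ι → ℂ} {S : Set ℝ}
    {x₀ : ℝ} {b : ι → ℝ} (hb : Summable b)
    (hlip : ∀ᶠ x in 𝓝[S] x₀, ∀ i, ‖g i x - g i x₀‖ ≤ b i * |x - x₀|)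
    (hd : ∀ i, HasDerivWithinAt (g i) (g' i) S x₀)
    (hs : ∀ᶠ x in 𝓝[S] x₀, Summable fun i => g i x) (hs₀ : Summable fun i => g i x₀) :
    HasDerivWithinAt (fun x => ∑' i, g i x) (∑' i, g' i) S x₀ := by
  rw [hasDerivWithinAt_iff_tendsto_slope]
  have hmono : 𝓝[S \ {x₀}] x₀ ≤ 𝓝[S] x₀ := nhdsWithin_mono _ sdiff_subset
  have h1 := tendsto_tsum_of_dominated_convergence (𝓕 := 𝓝[S \ {x₀}] x₀)
    (f := fun x i => slope (g i) x₀ x) (g := g') hb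
    (fun i => hasDerivWithinAt_iff_tendsto_slope.1 (hd i)) ?_
  · refine h1.congr' ?_
    filter_upwards [hmono hs] with x hx
    simp only [slope, vsub_eq_sub]
    rw [← hx.tsum_sub hs₀]
    exact (hx.sub hs₀).tsum_const_smul _
  · filter_upwards [hmono hlip, self_mem_nhdsWithin] with x hx hx' i
    have hne : 0 < |x - x₀| := abs_pos.2 (sub_ne_zero.2 hx'.2)
    rw [slope, vsub_eq_sub, norm_smul, norm_inv, Real.norm_eq_abs, inv_mul_le_iff₀ hne, mul_comm]
    exact hx i

theorem exists_hasDerivWithinAt_max_sub (q : ℝ) :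
    (∃ d : ℝ, HasDerivWithinAt (fun x => max (x - q) 0) d (Iic 1) 1) ∧
    ∃ d : ℝ, HasDerivWithinAt (fun x => max (x - q) 0) d (Ici 1) 1 := by
  have hpos : ∀ S : Set ℝ, (∀ᶠ x in 𝓝[S] 1, q ≤ x) → q ≤ 1 →
      HasDerivWithinAt (fun x => max (x - q) 0) 1 S 1 := by
    intro S hS hq
    refine ((hasDerivWithinAt_id _ _).sub_const q).congr_of_eventuallyEq ?_ (by simp [hq])
    filter_upwards [hS] with x hx
    simp [hx]
  have hneg : ∀ S : Set ℝ, (∀ᶠ x in 𝓝[S] 1, x ≤ q) → 1 ≤ q →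
      HasDerivWithinAt (fun x => max (x - q) 0) 0 S 1 := by
    intro S hS hq
    refine (hasDerivWithinAt_const _ _ (0 : ℝ)).congr_of_eventuallyEq ?_ (by simp [hq])
    filter_upwards [hS] with x hx
    simp [hx]
  constructor
  · rcases lt_or_ge q 1 with h | h
    · exact ⟨1, hpos _ (mem_nhdsWithin_of_mem_nhds (Ici_mem_nhds h)) h.le⟩
    · exact ⟨0, hneg _ (by
        filter_upwards [self_mem_nhdsWithin] with x hx using le_trans hx h) h⟩
  · rcases le_or_gt q 1 with h | h
    · exact ⟨1, hpos _ (by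
        filter_upwards [self_mem_nhdsWithin] with x hx using le_trans h hx) h⟩
    · exact ⟨0, hneg _ (mem_nhdsWithin_of_mem_nhds (Iic_mem_nhds h)) h.le⟩

theorem Complex.ofReal_div_cpow {p q : ℝ} (hp : 0 < p) (hq : 0 < q) (s : ℂ) :
    ((p / q : ℝ) : ℂ) ^ s = (p : ℂ) ^ s * (q : ℂ) ^ (-s) := by
  rw [div_eq_mul_inv, ofReal_mul, mul_cpow_ofReal_nonneg hp.le (inv_pos.2 hq).le, ofReal_inv,
    inv_cpow _ _ (by rw [arg_ofReal_of_nonneg hq.le]; exact Real.pi_ne_zero.symm), cpow_neg]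

section meanValue

variable {l : ℕ} {u v : ℂ}

set_option maxHeartbeats 1000000 in
-- Expanding both Dirichlet series gives terms a_(m,n) (m/n)^(-w) with a_(m,n) = σ_l(m)σ_l(n) m^(-u)
-- n^(-v). Perron's formula makes the integral equal to 2π ∑ a_(m,n) max(x - m/n, 0), and each ramp
-- has one-sided derivatives at 1.
theorem exists_hasDerivWithinAt_rieszIntegral_one {c : ℝ} (hc0 : 0 < c)
    (hcu : (l : ℝ) + 1 - u.re < c) (hcv : c < v.re - (l + 1)) :
    (∃ D, HasDerivWithinAt (rieszIntegral volume (fun y => divisorPair l u v (c + y * I))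
      (fun y => c + y * I) 1) D (Iic 1) 1) ∧
    ∃ D, HasDerivWithinAt (rieszIntegral volume (fun y => divisorPair l u v (c + y * I))
      (fun y => c + y * I) 1) D (Ici 1) 1 := by
  set w : ℝ → ℂ := fun y => c + y * I with hw
  set f : ℕ → ℂ := fun n => (ArithmeticFunction.sigma l n : ℂ) with hf
  set T : ℕ × ℕ → ℝ → ℂ := fun p y =>
    LSeries.term f (u + w y) p.1 * LSeries.term f (v - w y) p.2 with hT
  set B : ℕ × ℕ → ℝ := fun p => ‖LSeries.term f (u + c) p.1‖ * ‖LSeries.term f (v - c) p.2‖ with hB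
  have hwre : ∀ y, (w y).re = c := by simp [hw]
  have hsum1 : ∀ y, LSeriesHasSum f (u + w y) (divisorPhi l (u + w y)) := fun y =>
    LSeriesHasSum_sigma (by rw [add_re, hwre]; linarith)
  have hsum2 : ∀ y, LSeriesHasSum f (v - w y) (divisorPhi l (v - w y)) := fun y =>
    LSeriesHasSum_sigma (by rw [sub_re, hwre]; linarith)
  have hBsum : Summable B := by
    have h1 := (hsum1 0).summable.norm
    have h2 := (hsum2 0).summable.norm
    simp only [hw, ofReal_zero, zero_mul, add_zero] at h1 h2
    exact h1.mul_of_nonneg h2 (fun _ => norm_nonneg _) (fun _ => norm_nonneg _)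
  have hTnorm : ∀ p y, ‖T p y‖ = B p := by
    intro p y
    simp only [hT, hB, norm_mul, LSeries.norm_term_eq, add_re, sub_re, hwre, ofReal_re]
  have hTsum : ∀ y, HasSum (fun p => T p y) (divisorPair l u v (w y)) := by
    intro y
    have h1 := summable_mul_of_summable_norm (hsum1 y).summable.norm (hsum2 y).summable.norm
    have h2 := HasSum.mul (hsum1 y) (hsum2 y) h1
    exact h2
  have hc : ∀ j : ℕ, j ≤ 1 → c + j ≠ 0 := fun j _ => by positivity
  have hTcont : ∀ p, Continuous (T p) := by
    rintro ⟨m, n⟩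
    have h1 : ∀ (g : ℝ → ℂ), Continuous g → ∀ m, Continuous fun y => LSeries.term f (g y) m := by
      intro g hg m
      rcases eq_or_ne m 0 with rfl | hm
      · simpa using continuous_const
      · have hm0 : (m : ℂ) ≠ 0 := Nat.cast_ne_zero.2 hm
        simp only [LSeries.term_of_ne_zero hm]
        exact continuous_const.div (hg.const_cpow (Or.inl hm0)) fun y => by
          simp [cpow_eq_zero_iff, hm0]
    exact (h1 _ (by fun_prop) m).mul (h1 _ (by fun_prop) n)
  have hInt : ∀ x : ℝ, 0 < x → ∀ p, Integrable fun y => T p y / risingProd 1 (w y) *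
      (x : ℂ) ^ (w y + (1 : ℕ)) := fun x hx p =>
    integrable_rieszIntegrand (A := c) (B := c) (by fun_prop) (.of_forall fun y => by simp)
      (integrable_div_risingProd le_rfl hc (hTcont p) fun y => (hTnorm p y).le) hx
  have hswap : ∀ x : ℝ, 0 < x → HasSum (fun p => ∫ y, T p y / risingProd 1 (w y) * (x : ℂ) ^ (w y + (1 : ℕ)))
      (rieszIntegral volume (fun y => divisorPair l u v (w y)) w 1 x) := by
    intro x hx
    have h1 := hasSum_integral_of_summable_integral_norm (μ := volume)
      (F := fun p y => T p y / risingProd 1 (w y) * (x : ℂ) ^ (w y + (1 : ℕ))) (hInt x hx) ?_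
    · suffices e : rieszIntegral volume (fun y => divisorPair l u v (w y)) w 1 x =
          ∫ y, ∑' p, T p y / risingProd 1 (w y) * (x : ℂ) ^ (w y + (1 : ℕ)) by
        rw [e]
        exact h1
      refine integral_congr_ae (.of_forall fun y => ?_)
      simp only
      rw [tsum_mul_right, tsum_div_const, (hTsum y).tsum_eq]
    · simp only [norm_mul, hTnorm, div_eq_mul_inv, mul_assoc]
      simp only [integral_const_mul]
      exact hBsum.mul_right _
  set q : ℕ × ℕ → ℝ := fun p => (p.1 : ℝ) / p.2 with hq
  set a : ℕ × ℕ → ℂ := fun p => LSeries.term f u p.1 * LSeries.term f v p.2 with ha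
  have hTa : ∀ p y, T p y = a p * ((q p : ℝ) : ℂ) ^ (-w y) := by
    rintro ⟨m, n⟩ y
    rcases Nat.eq_zero_or_pos m with rfl | hm
    · simp [hT, ha]
    rcases Nat.eq_zero_or_pos n with rfl | hn
    · simp [hT, ha]
    have hm0 : (m : ℂ) ≠ 0 := Nat.cast_ne_zero.2 hm.ne'
    have hn0 : (n : ℂ) ≠ 0 := Nat.cast_ne_zero.2 hn.ne'
    simp only [hT, ha, hq]
    rw [ofReal_div_cpow (by exact_mod_cast hm) (by exact_mod_cast hn), ofReal_natCast,
      ofReal_natCast, neg_neg, LSeries.term_of_ne_zero hm.ne', LSeries.term_of_ne_zero hn.ne',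
      LSeries.term_of_ne_zero hm.ne', LSeries.term_of_ne_zero hn.ne', cpow_add _ _ hm0,
      cpow_sub _ _ hn0, cpow_neg]
    have e1 : (m : ℂ) ^ w y ≠ 0 := by simp [cpow_eq_zero_iff, hm0]
    have e2 : (n : ℂ) ^ w y ≠ 0 := by simp [cpow_eq_zero_iff, hn0]
    field_simp
  have hq0 : ∀ p, a p ≠ 0 → 0 < q p := by
    rintro ⟨m, n⟩ h
    have hm : m ≠ 0 := by rintro rfl; simp [ha] at h
    have hn : n ≠ 0 := by rintro rfl; simp [ha] at h
    simp only [hq]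
    positivity
  have hval : ∀ x : ℝ, 0 < x → ∀ p, ∫ y, T p y / risingProd 1 (w y) * (x : ℂ) ^ (w y + (1 : ℕ)) =
      2 * π * a p * ((max (x - q p) 0 : ℝ) : ℂ) := by
    intro x hx p
    by_cases hap : a p = 0
    · simp [hTa, hap]
    have hqp := hq0 p hap
    have hx0 : (x : ℂ) ≠ 0 := ofReal_ne_zero.2 hx.ne'
    have e1 : ∀ y, T p y / risingProd 1 (w y) * (x : ℂ) ^ (w y + (1 : ℕ)) =
        a p * x * (((q p / x : ℝ) : ℂ) ^ (-w y) / risingProd 1 (w y)) := by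
      intro y
      rw [hTa, ofReal_div_cpow hqp hx, neg_neg, cpow_add _ _ hx0, Nat.cast_one, cpow_one]
      ring
    simp only [e1]
    rw [integral_const_mul, integral_cpow_neg_div_risingProd_one hc0 (div_pos hqp hx)]
    have e2 : max (x - q p) 0 = x * max (1 - q p / x) 0 := by
      rw [mul_max_of_nonneg _ _ hx.le, mul_zero, mul_sub, mul_one, mul_div_cancel₀ _ hx.ne']
    rw [e2]
    push_cast
    ring
  set g : ℕ × ℕ → ℝ → ℂ := fun p x => 2 * π * a p * ((max (x - q p) 0 : ℝ) : ℂ) with hg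
  have hgsum : ∀ x : ℝ, 0 < x → HasSum (fun p => g p x)
      (rieszIntegral volume (fun y => divisorPair l u v (w y)) w 1 x) := by
    intro x hx
    have := hswap x hx
    simp only [hval x hx] at this
    exact this
  -- The a_(m,n) themselves need not be absolutely summable, as Re u or Re v may be small. For x < 2
  -- only terms with m/n ≤ 2 are nonzero, and these are controlled by the summable weights on the
  -- line Re w = c.
  have hab : ∀ p, q p ≤ 2 → ‖a p‖ ≤ 2 ^ c * B p := by
    intro p h2
    by_cases hap : a p = 0
    · rw [hap, norm_zero]; positivity
    have hqp := hq0 p hap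
    have h3 := hTnorm p 0
    rw [hTa, norm_mul, norm_cpow_eq_rpow_re_of_pos hqp, neg_re, hwre, Real.rpow_neg hqp.le] at h3
    have h4 : (q p) ^ c ≤ 2 ^ c := Real.rpow_le_rpow hqp.le h2 hc0.le
    have h5 := Real.rpow_pos_of_pos hqp c
    rw [← h3]
    calc ‖a p‖ = (q p) ^ c * (‖a p‖ * ((q p) ^ c)⁻¹) := by field_simp
      _ ≤ _ := by gcongr
  have hlip : ∀ x : ℝ, x < 2 → ∀ p, ‖g p x - g p 1‖ ≤ 2 * π * (2 ^ c * B p) * |x - 1| := by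
    intro x hx p
    simp only [hg, ← mul_sub, ← ofReal_sub]
    rw [norm_mul, norm_mul, norm_real, norm_mul, norm_ofNat, norm_real,
      Real.norm_of_nonneg Real.pi_pos.le, Real.norm_eq_abs]
    rcases le_or_gt (q p) 2 with h | h
    · have h1 : |max (x - q p) 0 - max (1 - q p) 0| ≤ |x - 1| := by
        refine (abs_max_sub_max_le_abs _ _ _).trans (le_of_eq ?_)
        congr 1; ring
      have := hab p h
      gcongr
    · rw [max_eq_right (by linarith), max_eq_right (by linarith), sub_zero, abs_zero, mul_zero]
      positivity
  have hbsum : Summable fun p => 2 * π * (2 ^ c * B p) := (hBsum.mul_left _).mul_left _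
  have hev0 : ∀ S : Set ℝ, ∀ᶠ x in 𝓝[S] (1 : ℝ), 0 < x := fun S =>
    mem_nhdsWithin_of_mem_nhds (Ioi_mem_nhds one_pos)
  have hev2 : ∀ S : Set ℝ, ∀ᶠ x in 𝓝[S] (1 : ℝ), x < 2 := fun S =>
    mem_nhdsWithin_of_mem_nhds (Iio_mem_nhds one_lt_two)
  have hmain : ∀ S : Set ℝ, (∀ q : ℝ, ∃ d : ℝ, HasDerivWithinAt (fun x => max (x - q) 0) d S 1) →
      ∃ D, HasDerivWithinAt (rieszIntegral volume (fun y => divisorPair l u v (w y)) w 1) D S 1 := by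
    intro S hS
    choose d hd using hS
    refine ⟨_, (hasDerivWithinAt_tsum_of_lipschitz (g := g)
      (g' := fun p => 2 * π * a p * (d (q p) : ℂ)) hbsum
      ((hev2 S).mono fun x hx => hlip x hx) (fun p => ?_)
      ((hev0 S).mono fun x hx => (hgsum x hx).summable)
      (hgsum 1 one_pos).summable).congr_of_eventuallyEq ?_ ?_⟩
    · exact ((hd (q p)).ofReal_comp).const_mul _
    · filter_upwards [hev0 S] with x hx using (hgsum x hx).tsum_eq.symm
    · exact (hgsum 1 one_pos).tsum_eq.symm
  exact ⟨hmain _ fun q => (exists_hasDerivWithinAt_max_sub q).1,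
    hmain _ fun q => (exists_hasDerivWithinAt_max_sub q).2⟩

/-! ### Reflection of the line of integration -/

/-- The substitution `w ↦ -w` exchanges left and right derivatives at `1`. -/
theorem hasDerivWithinAt_rieszIntegral_neg {c : ℝ} (hc0 : 0 < c) (hc1 : c ≠ 1)
    (hcu : (l : ℝ) + 1 - u.re < c) (hcv : c < v.re - (l + 1)) {S S' : Set ℝ} {D : ℂ}
    (h1S : (1 : ℝ) ∈ S) (hSS' : ∀ x ∈ S, 0 < x → x⁻¹ ∈ S')
    (hD : HasDerivWithinAt (rieszIntegral volume (fun y => divisorPair l u v (c + y * I))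
      (fun y => c + y * I) 1) D S' 1) :
    HasDerivWithinAt (rieszIntegral volume (fun y => divisorPair l v u ((-c : ℝ) + y * I))
      (fun y => (-c : ℝ) + y * I) 1) (-D) S 1 := by
  set W : ℝ → ℂ := fun y => (-c : ℝ) + y * I with hW
  set H : ℝ → ℂ := fun y => divisorPair l v u (W y) with hH
  set J := rieszIntegral volume (fun y => divisorPair l u v (c + y * I)) (fun y => c + y * I) 1
    with hJ
  have hWc : Continuous W := by fun_prop
  have hWre : ∀ y, (W y).re = -c := by simp [hW]
  obtain ⟨hcont, C, hC⟩ := exists_norm_divisorPair_le (l := l) (u := v) (v := u) (c := -c)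
    (by linarith) (by linarith)
  have hcj : ∀ j : ℕ, j ≤ 1 → -c + j ≠ 0 := by
    intro j hj h
    interval_cases j
    · simp at h; linarith
    · apply hc1; push_cast at h; linarith
  obtain ⟨hcont', C', hC'⟩ := exists_norm_divisorPair_le hcu hcv
  have hW0 : ∀ y, W y ≠ 0 := fun y h => by have := congrArg re h; simp [hWre] at this; linarith
  have hW1 : ∀ y, W y + 1 ≠ 0 := fun y h => by
    have := congrArg re h; simp [hWre] at this; apply hc1; linarith
  have hWm : ∀ y, W y - 1 ≠ 0 := fun y h => by have := congrArg re h; simp [hWre] at this; linarith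
  have hneg : ∀ y : ℝ, (c + (-y : ℝ) * I : ℂ) = -W y := fun y => by simp [hW]; ring
  have hpair : ∀ y, divisorPair l u v (-W y) = H y := by
    intro y
    simp only [hH, divisorPair]
    rw [mul_comm]
    congr 2 <;> ring
  have hr1 : ∀ z : ℂ, risingProd 1 z = z * (z + 1) := fun z => by
    simp [risingProd, Finset.prod_range_succ]
  -- `J` in terms of the reflected line
  have hJint : ∀ x : ℝ, 0 < x → Integrable fun y => H y / (W y * (W y - 1)) * (x : ℂ) ^ (1 - W y) := by
    intro x hx
    have h1 := (integrable_rieszIntegrand (μ := volume) (m := 1) (A := c) (B := c)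
      (w := fun y : ℝ => (c + y * I : ℂ)) (by fun_prop) (.of_forall fun y => by simp)
      (integrable_div_risingProd le_rfl (fun j _ => by positivity) hcont' hC') hx).comp_neg
    refine h1.congr (.of_forall fun y => ?_)
    simp only [hneg, hpair, hr1]
    congr 2
    · ring
    · push_cast; ring
  have hJeq : ∀ x : ℝ, J x = ∫ y, H y / (W y * (W y - 1)) * (x : ℂ) ^ (1 - W y) := by
    intro x
    rw [hJ, rieszIntegral, ← integral_neg_eq_self]
    refine integral_congr_ae (.of_forall fun y => ?_)
    simp only [hneg, hpair, hr1]
    congr 2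
    · ring
    · push_cast; ring
  -- Reflection turns the kernel 1/(w(w + 1)) into 1/(W(W - 1)) instead of 1/(W(W + 1)). The
  -- correction K has an extra factor 1/(W - 1), so it is differentiable from both sides.
  set K := rieszIntegral volume (fun y => H y / (W y - 1)) W 1 with hK
  have hHb : Continuous (fun y => H y / (W y - 1)) ∧ ∀ y, ‖H y / (W y - 1)‖ ≤ C := by
    refine ⟨hcont.div (by fun_prop) hWm, fun y => ?_⟩
    have h1 : 1 ≤ ‖W y - 1‖ := by
      have := abs_re_le_norm (W y - 1)
      simp only [sub_re, hWre, one_re] at this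
      rw [abs_of_neg (by linarith)] at this
      linarith
    rw [norm_div, div_le_iff₀ (by linarith)]
    exact (hC y).trans (le_mul_of_one_le_right ((norm_nonneg _).trans (hC y)) h1)
  have hKder : HasDerivAt K (J 1) 1 := by
    have h1 := hasDerivAt_rieszIntegral (μ := volume) (H := fun y => H y / (W y - 1)) (w := W)
      (A := -c) (B := -c) (m := 0) hWc (.of_forall fun y => by simp [hWre])
      (.of_forall fun y => by simpa using hW1 y) ?_
      (integrable_div_risingProd le_rfl hcj hHb.1 hHb.2) one_pos
    · convert h1 using 1
      rw [hJeq, rieszIntegral]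
      refine integral_congr_ae (.of_forall fun y => ?_)
      simp [risingProd, div_div, mul_comm]
    · refine (hJint 1 one_pos).congr (.of_forall fun y => ?_)
      simp [risingProd, div_div, mul_comm]
  -- This is 1/(W(W + 1)) = 1/(W(W - 1)) - 2/((W - 1)W(W + 1)). At x = 1 the derivative 2J(1) coming
  -- from x² cancels 2K'(1) = 2J(1), leaving only the derivative of J(1/x).
  have hId : ∀ x : ℝ, 0 < x → rieszIntegral volume H W 1 x = (x : ℂ) ^ 2 * J x⁻¹ - 2 * K x := by
    intro x hx
    have hx0 : (x : ℂ) ≠ 0 := ofReal_ne_zero.2 hx.ne'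
    have i1 := (hJint x⁻¹ (inv_pos.2 hx)).const_mul ((x : ℂ) ^ 2)
    have i2 := (integrable_rieszIntegrand (μ := volume) (m := 1) (A := -c) (B := -c) (w := W) hWc
      (.of_forall fun y => by simp [hWre])
      (integrable_div_risingProd le_rfl hcj hHb.1 hHb.2) hx).const_mul 2
    rw [hJeq, hK, rieszIntegral, rieszIntegral, ← integral_const_mul, ← integral_const_mul,
      ← integral_sub i1 i2]
    refine integral_congr_ae (.of_forall fun y => ?_)
    have e1 : ((x⁻¹ : ℝ) : ℂ) ^ (1 - W y) = (x : ℂ) ^ (W y + 1) * ((x : ℂ) ^ 2)⁻¹ := by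
      rw [ofReal_inv, inv_cpow _ _ (by
        rw [arg_ofReal_of_nonneg hx.le]; exact Real.pi_ne_zero.symm), ← cpow_neg]
      have : -(1 - W y) = (W y + 1) - (2 : ℕ) := by push_cast; ring
      rw [this, cpow_sub _ _ hx0, cpow_natCast, div_eq_mul_inv]
    simp only [hr1, e1, Nat.cast_one]
    have := hW0 y
    have := hW1 y
    have := hWm y
    generalize (x : ℂ) ^ (W y + 1) = X
    field_simp
    ring
  have hInv : HasDerivWithinAt (fun x : ℝ => J x⁻¹) (-D) (S ∩ Ioi 0) 1 := by
    have h1 : HasDerivWithinAt (fun x : ℝ => x⁻¹) (-1 : ℝ) (S ∩ Ioi 0) 1 := by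
      simpa using (hasDerivAt_inv (one_ne_zero (α := ℝ))).hasDerivWithinAt (s := S ∩ Ioi 0)
    have h2 : HasDerivWithinAt (fun x : ℝ => J x⁻¹) ((-1 : ℝ) • D) (S ∩ Ioi 0) 1 :=
      HasDerivWithinAt.scomp (h := fun x : ℝ => x⁻¹) (g₁ := J) (g₁' := D) (1 : ℝ)
      (by simpa using hD) h1 (fun x hx => hSS' x hx.1 hx.2)
    rwa [neg_one_smul] at h2
  have hsq : HasDerivAt (fun x : ℝ => (x : ℂ) ^ 2) 2 1 := by
    simpa using (hasDerivAt_pow 2 ((1 : ℝ) : ℂ)).comp_ofReal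
  have hfin := (hsq.hasDerivWithinAt.mul hInv).sub (hKder.hasDerivWithinAt.const_mul 2)
  have hfin2 : HasDerivWithinAt (rieszIntegral volume H W 1) (-D) (S ∩ Ioi 0) 1 := by
    refine (hfin.congr_of_mem (fun x hx => hId x hx.2) ⟨h1S, by simp⟩).congr_deriv ?_
    simp
  exact hfin2.mono_of_mem_nhdsWithin (inter_mem self_mem_nhdsWithin
    (mem_nhdsWithin_of_mem_nhds (Ioi_mem_nhds one_pos)))

end meanValue

/-! ### Assembling the formula -/

theorem product_formula_of_re_le (l k : ℕ) (hl : Odd l) (hk : l + 1 < k)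
    (γ : ℝ) (hγ : (l : ℝ) + 1 < γ) (hγk : 2 * γ - (l + 1) < k)
    (u v : ℂ) (huv : 2 * (l : ℝ) + 2 < u.re + v.re) (hle : u.re ≤ v.re)
    (hu : (l : ℝ) + 1 - γ < u.re) (hv : (l : ℝ) + 1 - γ < v.re)
    (hu1 : u ≠ 1) (hul : u ≠ l + 1) (hv1 : v ≠ 1) (hvl : v ≠ l + 1)
    (hγu : ∀ j : ℕ, j ≤ k → (l : ℝ) + 1 - u.re + j ≠ γ)
    (hγv : ∀ j : ℕ, j ≤ k → (l : ℝ) + 1 - v.re + j ≠ γ) :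
    DivisorGConverges l k γ u v ∧ DivisorGConverges l k γ v u ∧
    ∃ Duv Dvu : ℂ,
      HasMeanIteratedDerivAt k (divisorG l k γ u v) Duv 1 ∧
      HasMeanIteratedDerivAt k (divisorG l k γ v u) Dvu 1 ∧
      divisorPhi l u * divisorPsi l v =
        - ((-1 : ℂ) ^ ((l + 1) / 2) * (riemannZeta (1 - l) / (1 - v)) * divisorPhi l (u + v - 1))
        - (-1 : ℂ) ^ ((l + 1) / 2) * (riemannZeta (1 + l) / (l + 1 - v)) *
            divisorPhi l (u + v - l - 1)
        - riemannZeta (1 - l) / (1 - u) * divisorPsi l (u + v - 1)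
        - riemannZeta (1 + l) / (l + 1 - u) * divisorPsi l (u + v - l - 1)
        - Duv - Dvu := by
  -- A positive c is available because Re v, being the larger real part, exceeds l + 1.
  -- Irrationality keeps the zeros -j of the rising product off the reflected line Re w = -c.
  obtain ⟨c, hirr, hc1, hc2⟩ := exists_irrational_btwn
    (show max 0 ((l : ℝ) + 1 - u.re) < v.re - (l + 1) from max_lt (by linarith) (by linarith))
  have hc0 : 0 < c := (le_max_left _ _).trans_lt hc1
  have hcu : (l : ℝ) + 1 - u.re < c := (le_max_right _ _).trans_lt hc1
  have hcn : ∀ j : ℕ, -c + j ≠ 0 := fun j h => hirr.ne_nat j (by linarith)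
  obtain ⟨⟨D₁, h₁⟩, D₂, h₂⟩ := exists_hasDerivWithinAt_rieszIntegral_one hc0 hcu hc2
  have hc1' : c ≠ 1 := by simpa using hirr.ne_nat 1
  -- Inversion x ↦ 1/x swaps the sides, so the left derivative here comes from the right derivative
  -- D₂. Both means contain D₁ + D₂, with opposite signs.
  have h₁' := hasDerivWithinAt_rieszIntegral_neg hc0 hc1' hcu hc2 (S := Iic 1) (by simp)
    (fun x hx hx0 => (one_le_inv₀ hx0).2 hx) h₂
  have h₂' := hasDerivWithinAt_rieszIntegral_neg hc0 hc1' hcu hc2 (S := Ici 1) (by simp)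
    (fun x hx _ => mem_Iic.2 (inv_le_one_of_one_le₀ (mem_Ici.1 hx))) h₁
  obtain ⟨a1, a2⟩ := HasMeanIteratedDerivAt.of_riesz hl hk hγ hγk huv hu hu1 hul hγu hcu hc2
    (fun j _ => by positivity) h₁ h₂
  obtain ⟨b1, b2⟩ := HasMeanIteratedDerivAt.of_riesz hl hk hγ hγk (by linarith) hv hv1 hvl hγv
    (by linarith) (by linarith) (fun j _ => hcn j) h₁' h₂'
  refine ⟨a1, b1, _, _, a2, b2, ?_⟩
  rw [if_pos hc0, if_neg (by linarith), add_comm v u]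
  simp only [divisorPsi]
  ring

theorem mainTheorem3 (l k : ℕ) (hl : Odd l) (hk : l + 1 < k)
    (γ : ℝ) (hγ : (l : ℝ) + 1 < γ) (hγk : 2 * γ - (l + 1) < k)
    (u v : ℂ) (huv : 2 * (l : ℝ) + 2 < u.re + v.re)
    (hu : (l : ℝ) + 1 - γ < u.re) (hv : (l : ℝ) + 1 - γ < v.re)
    (hu1 : u ≠ 1) (hul : u ≠ l + 1) (hv1 : v ≠ 1) (hvl : v ≠ l + 1)
    (hγu : ∀ j : ℕ, j ≤ k → (l : ℝ) + 1 - u.re + j ≠ γ)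
    (hγv : ∀ j : ℕ, j ≤ k → (l : ℝ) + 1 - v.re + j ≠ γ) :
    DivisorGConverges l k γ u v ∧ DivisorGConverges l k γ v u ∧
    ∃ Duv Dvu : ℂ,
      HasMeanIteratedDerivAt k (divisorG l k γ u v) Duv 1 ∧
      HasMeanIteratedDerivAt k (divisorG l k γ v u) Dvu 1 ∧
      divisorPhi l u * divisorPsi l v =
        - ((-1 : ℂ) ^ ((l + 1) / 2) * (riemannZeta (1 - l) / (1 - v)) * divisorPhi l (u + v - 1))
        - (-1 : ℂ) ^ ((l + 1) / 2) * (riemannZeta (1 + l) / (l + 1 - v)) *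
            divisorPhi l (u + v - l - 1)
        - riemannZeta (1 - l) / (1 - u) * divisorPsi l (u + v - 1)
        - riemannZeta (1 + l) / (l + 1 - u) * divisorPsi l (u + v - l - 1)
        - Duv - Dvu := by
  rcases le_total u.re v.re with h | h
  · exact product_formula_of_re_le l k hl hk γ hγ hγk u v huv h hu hv hu1 hul hv1 hvl hγu hγv
  -- The formula is symmetric in u and v because ψ = εφ.
  · obtain ⟨c1, c2, Dvu, Duv, d1, d2, e⟩ := product_formula_of_re_le l k hl hk γ hγ hγk v u
      (by linarith) h hv hu hv1 hvl hu1 hul hγv hγu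
    refine ⟨c2, c1, Duv, Dvu, d2, d1, ?_⟩
    rw [add_comm v u] at e
    simp only [divisorPsi] at e ⊢
    linear_combination e
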